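/- Let $p\ge 1$, let $\boldsymbol\mu\in\mathbb R^p$ and let $\boldsymbol\Sigma\in\mathbb R^{p\times p}$ be symmetric positive semidefinite with $\boldsymbol\Sigma\neq 0$. Let $n,m\ge 2$ be integers, $k=n/m$ and $w\in(0,1]$. For points $\boldsymbol z_1,\dots,\boldsymbol z_N\in\mathbb R^p$ write $\bar{\boldsymbol z}=\frac1N\sum_i \boldsymbol z_i$ for the sample mean and $\frac1{N-1}\sum_i(\boldsymbol z_i-\bar{\boldsymbol z})(\boldsymbol z_i-\bar{\boldsymbol z})^\top$ for the sample covariance. Consider the following recursive estimation scheme. At step $0$, $\boldsymbol\mu_0$ and $\boldsymbol\Sigma_0$ are the sample mean and sample covariance of $n$ i.i.d. points from $N(\boldsymbol\mu,\boldsymbol\Sigma)$. At step $t\ge 1$, conditionally on all data used in the steps $0,\dots,t-1$, one draws independently $n$ fresh i.i.d. real points from $N(\boldsymbol\mu,\boldsymbol\Sigma)$, with sample mean $\widehat{\boldsymbol\mu}_t$ and sample covariance $\widehat{\boldsymbol S}_t$, and $m$ i.i.d. synthetic points from $N(\boldsymbol\mu_{t-1},\boldsymbol\Sigma_{t-1})$,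 with sample mean $\widetilde{\boldsymbol\mu}_t$ and sample covariance $\widetilde{\boldsymbol S}_t$, and sets $$\boldsymbol\mu_t=w\widehat{\boldsymbol\mu}_t+(1-w)\widetilde{\boldsymbol\mu}_t,\qquad \boldsymbol\Sigma_t=w\widehat{\boldsymbol S}_t+(1-w)\widetilde{\boldsymbol S}_t .$$ Then $$\lim_{t\to\infty}\mathbb E\,\|\boldsymbol\mu_t-\boldsymbol\mu\|_2^2=\frac{C(w,k)\,\mathrm{tr}(\boldsymbol\Sigma)}{n},\qquad C(w,k)=\frac{w^2+(1-w)^2k}{2w-w^2},$$ and $$\lim_{t\to\infty}\mathbb E\,\|\boldsymbol\Sigma_t-\boldsymbol\Sigma\|_F^2=\begin{cases}\infty, & 0<w\le 1-\sqrt{\frac{m-1}{m+1}},\\[2pt] \dfrac ND-\mathrm{tr}(\boldsymbol\Sigma^2), & 1-\sqrt{\frac{m-1}{m+1}}<w\le 1,\end{cases}$$ where, writing $\mathrm{tr}^2(\boldsymbol\Sigma)=[\mathrm{tr}(\boldsymbol\Sigma)]^2$, $$N=(2w-w^2)\,\mathrm{tr}(\boldsymbol\Sigma^2)+\frac{(w-1)^2\Big[\mathrm{tr}^2(\boldsymbol\Sigma)(2w-w^2)+\frac{2w^2\,\mathrm{tr}(\boldsymbol\Sigma^2)}{n-1}\Big]}{(m-1)(2w-w^2)}+\frac{w^2\big[\mathrm{tr}^2(\boldsymbol\Sigma)+\mathrm{tr}(\boldsymbol\Sigma^2)\big]}{n-1},$$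 $$D=2w-w^2-\frac{2(w-1)^4}{(m-1)^2(2w-w^2)}-\frac{(w-1)^2}{m-1}.$$ -/

import Mathlib

open MeasureTheory ProbabilityTheory Filter Topology

namespace FreshAugmentation

noncomputable section

/-- The sample mean `(1/N) ∑ zᵢ` of `N` points of `ℝᵖ`. -/
def sampleMean {p N : ℕ} (z : Fin N → EuclideanSpace ℝ (Fin p)) : EuclideanSpace ℝ (Fin p) :=
  (N : ℝ)⁻¹ • ∑ i, z i

/-- The unbiased sample covariance `(1/(N-1)) ∑ (zᵢ - z̄)(zᵢ - z̄)ᵀ` of `N` points of `ℝᵖ`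
(meaningful for `N ≥ 2`). -/
def sampleCov {p N : ℕ} (z : Fin N → EuclideanSpace ℝ (Fin p)) : Matrix (Fin p) (Fin p) ℝ :=
  ((N : ℝ) - 1)⁻¹ •
    ∑ i, Matrix.vecMulVec (z i - sampleMean z).ofLp (z i - sampleMean z).ofLp

/-- The squared Frobenius norm of a real matrix. -/
def frobeniusSq {p : ℕ} (A : Matrix (Fin p) (Fin p) ℝ) : ℝ :=
  ∑ i, ∑ j, A i j ^ 2

/-- The mean estimator at step `t`. Here `x t` is the real dataset collected at step `t`, and
`y t` is the synthetic dataset generated from the model of step `t` and used at step `t + 1`. -/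
def meanEst {Ω : Type*} {p n m : ℕ} (w : ℝ)
    (x : ℕ → Fin n → Ω → EuclideanSpace ℝ (Fin p))
    (y : ℕ → Fin m → Ω → EuclideanSpace ℝ (Fin p)) :
    ℕ → Ω → EuclideanSpace ℝ (Fin p)
  | 0, ω => sampleMean (fun i => x 0 i ω)
  | t + 1, ω =>
      w • sampleMean (fun i => x (t + 1) i ω) + (1 - w) • sampleMean (fun i => y t i ω)

/-- The covariance estimator at step `t` (same conventions as for `meanEst`). -/
def covEst {Ω : Type*} {p n m : ℕ} (w : ℝ)
    (x : ℕ → Fin n → Ω → EuclideanSpace ℝ (Fin p))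
    (y : ℕ → Fin m → Ω → EuclideanSpace ℝ (Fin p)) :
    ℕ → Ω → Matrix (Fin p) (Fin p) ℝ
  | 0, ω => sampleCov (fun i => x 0 i ω)
  | t + 1, ω =>
      w • sampleCov (fun i => x (t + 1) i ω) + (1 - w) • sampleCov (fun i => y t i ω)

/-- The information available once step `t` has been trained: the σ-algebra generated by the real
datasets `x 0, …, x t` and the synthetic datasets `y 0, …, y (t - 1)`. -/
abbrev history {Ω : Type*} {p n m : ℕ}
    (x : ℕ → Fin n → Ω → EuclideanSpace ℝ (Fin p))
    (y : ℕ → Fin m → Ω → EuclideanSpace ℝ (Fin p)) (t : ℕ) : MeasurableSpace Ω :=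
  (⨆ s, ⨆ (_ : s ≤ t), ⨆ i, MeasurableSpace.comap (x s i) inferInstance) ⊔
    (⨆ s, ⨆ (_ : s < t), ⨆ i, MeasurableSpace.comap (y s i) inferInstance)

/-- The law of an i.i.d. sample of size `N` from the Gaussian distribution `N(μ, S)` on `ℝᵖ`. -/
def gaussianSample {p : ℕ} (N : ℕ) (μ : EuclideanSpace ℝ (Fin p)) (S : Matrix (Fin p) (Fin p) ℝ) :
    Measure (Fin N → EuclideanSpace ℝ (Fin p)) :=
  Measure.pi (fun _ : Fin N => multivariateGaussian μ S)

/-- The datasets `x`, `y` follow the recursive training scheme with weight `w` and real data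
distribution `N(μ, S)`: the initial real dataset is an i.i.d. sample from `N(μ, S)`, and,
conditionally on the history up to step `t`, the next real dataset `x (t + 1)` and the synthetic
dataset `y t` are independent i.i.d. samples from `N(μ, S)` and from the fitted model
`N(meanEst t, covEst t)` respectively. -/
structure IsScheme {Ω : Type*} [MeasurableSpace Ω] (P : Measure Ω) {p n m : ℕ} (w : ℝ)
    (μ : EuclideanSpace ℝ (Fin p)) (S : Matrix (Fin p) (Fin p) ℝ)
    (x : ℕ → Fin n → Ω → EuclideanSpace ℝ (Fin p))
    (y : ℕ → Fin m → Ω → EuclideanSpace ℝ (Fin p)) : Prop where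
  measurable_real : ∀ t i, Measurable (x t i)
  measurable_synthetic : ∀ t i, Measurable (y t i)
  law_init : P.map (fun ω i => x 0 i ω) = gaussianSample n μ S
  cond_law : ∀ t, ∀ B : Set ((Fin n → EuclideanSpace ℝ (Fin p)) ×
      (Fin m → EuclideanSpace ℝ (Fin p))), MeasurableSet B →
    P⟦{ω | ((fun i => x (t + 1) i ω), (fun i => y t i ω)) ∈ B} | history x y t⟧ =ᵐ[P]
      fun ω => ((gaussianSample n μ S).prod
        (gaussianSample m (meanEst w x y t ω) (covEst w x y t ω))).real B

/-- The mean error `E ‖μ_t - μ‖²`, as an expectation with values in `[0, ∞]`, viewed in the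
extended reals. -/
def errMean {Ω : Type*} [MeasurableSpace Ω] (P : Measure Ω) {p n m : ℕ} (w : ℝ)
    (μ : EuclideanSpace ℝ (Fin p))
    (x : ℕ → Fin n → Ω → EuclideanSpace ℝ (Fin p))
    (y : ℕ → Fin m → Ω → EuclideanSpace ℝ (Fin p)) (t : ℕ) : EReal :=
  ((∫⁻ ω, ENNReal.ofReal (‖meanEst w x y t ω - μ‖ ^ 2) ∂P : ENNReal) : EReal)

/-- The covariance error `E ‖Σ_t - S‖_F²`, as an expectation with values in `[0, ∞]`, viewed in
the extended reals. -/
def errCov {Ω : Type*} [MeasurableSpace Ω] (P : Measure Ω) {p n m : ℕ} (w : ℝ)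
    (S : Matrix (Fin p) (Fin p) ℝ)
    (x : ℕ → Fin n → Ω → EuclideanSpace ℝ (Fin p))
    (y : ℕ → Fin m → Ω → EuclideanSpace ℝ (Fin p)) (t : ℕ) : EReal :=
  ((∫⁻ ω, ENNReal.ofReal (frobeniusSq (covEst w x y t ω - S)) ∂P : ENNReal) : EReal)

/-- The constant `C(w, k)`. -/
def constC (w k : ℝ) : ℝ := (w ^ 2 + (1 - w) ^ 2 * k) / (2 * w - w ^ 2)

/-- The numerator `N` of the limiting covariance error. -/
def numN {p : ℕ} (n m : ℕ) (w : ℝ) (S : Matrix (Fin p) (Fin p) ℝ) : ℝ :=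
  (2 * w - w ^ 2) * (S ^ 2).trace
    + (w - 1) ^ 2 * (S.trace ^ 2 * (2 * w - w ^ 2) + 2 * w ^ 2 * (S ^ 2).trace / ((n : ℝ) - 1))
        / (((m : ℝ) - 1) * (2 * w - w ^ 2))
    + w ^ 2 * (S.trace ^ 2 + (S ^ 2).trace) / ((n : ℝ) - 1)

/-- The denominator `D` of the limiting covariance error. -/
def denD (m : ℕ) (w : ℝ) : ℝ :=
  2 * w - w ^ 2
    - 2 * (w - 1) ^ 4 / (((m : ℝ) - 1) ^ 2 * (2 * w - w ^ 2))
    - (w - 1) ^ 2 / ((m : ℝ) - 1)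

end

end FreshAugmentation

namespace FreshAugmentation

open scoped NNReal ENNReal

/-! ### Fourth moments of Gaussian measures -/

/-! Conditionally on the past, the mean and covariance estimators of one step are weighted sums of
two independent Gaussian sample statistics, so their first two moments are explicit; averaging over
the past turns the errors into affine recursions.

For the mean, `E tr Σ_t = tr Σ` makes the recursion scalar, with factor `(1-w)² < 1`, and its fixed
point is the limit.

For the covariance, unbiasedness gives `E‖Σ_t - Σ‖² = E‖Σ_t‖² - tr Σ²`. Isserlis' formula
(`integral_dual_mul_four`) yields the second moments of a sample covariance
(`integral_sampleCov_mul`). Contracting indices shows that `A_t = E‖Σ_t‖²` and `B_t = E (tr Σ_t)²`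
form a closed linear system. With `a = (1-w)²` and `c = 1/(m-1)`, its matrix is `a` times `[[1+c,
c], [2c, 1]]`, with eigenvalues `a(1+2c)` and `a(1-c)`. The second is always below 1; the first,
`(1-w)²(m+1)/(m-1)`, reaches 1 exactly at the stated threshold (`tendsto_coupled_recursion`,
`le_one_sub_sqrt_iff`). Below 1, solving for the fixed point gives `N/D`.

The passage from conditional laws to expectations is `lintegral_eq_lintegral_condLaw` and its
real-valued corollaries. -/

theorem integral_pow_four_gaussianReal (v : ℝ≥0) :
    ∫ x, x ^ 4 ∂gaussianReal 0 v = 3 * (v : ℝ) ^ 2 := by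
  -- The fourth moment is the fourth derivative at 0 of the moment generating function `exp (v t² /
  -- 2)`; `e1` to `e4` take the derivatives one at a time.
  have h := iteratedDeriv_mgf_zero (X := id) (μ := gaussianReal 0 v)
    (by rw [integrableExpSet_id_gaussianReal]; simp) 4
  have e : mgf id (gaussianReal 0 v) = fun t => Real.exp (v * t ^ 2 / 2) := by
    rw [mgf_id_gaussianReal]; simp
  have d0 : ∀ t : ℝ, HasDerivAt (fun t : ℝ => Real.exp (v * t ^ 2 / 2))
      (Real.exp (v * t ^ 2 / 2) * (v * t)) t := by
    intro t
    have := ((((hasDerivAt_id t).pow 2).const_mul (v : ℝ)).div_const 2).exp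
    refine this.congr_deriv ?_
    simp
    ring
  have e1 : deriv (fun t : ℝ => Real.exp (v * t ^ 2 / 2)) =
      fun t => Real.exp (v * t ^ 2 / 2) * (v * t) := by
    funext t; exact (d0 t).deriv
  have e2 : deriv (fun t : ℝ => Real.exp (v * t ^ 2 / 2) * (v * t)) =
      fun t => Real.exp (v * t ^ 2 / 2) * (v ^ 2 * t ^ 2 + v) := by
    funext t
    have := (d0 t).mul ((hasDerivAt_id t).const_mul (v : ℝ))
    refine (this.congr_deriv ?_).deriv
    simp
    ring
  have e3 : deriv (fun t : ℝ => Real.exp (v * t ^ 2 / 2) * (v ^ 2 * t ^ 2 + v)) =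
      fun t => Real.exp (v * t ^ 2 / 2) * (v ^ 3 * t ^ 3 + 3 * v ^ 2 * t) := by
    funext t
    have := (d0 t).mul ((((hasDerivAt_id t).pow 2).const_mul ((v : ℝ) ^ 2)).add_const (v : ℝ))
    refine (this.congr_deriv ?_).deriv
    simp
    ring
  have e4 : deriv (fun t : ℝ => Real.exp (v * t ^ 2 / 2) * (v ^ 3 * t ^ 3 + 3 * v ^ 2 * t)) 0 =
      3 * (v : ℝ) ^ 2 := by
    have := (d0 0).mul ((((hasDerivAt_id (0 : ℝ)).pow 3).const_mul ((v : ℝ) ^ 3)).add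
      ((hasDerivAt_id (0 : ℝ)).const_mul (3 * (v : ℝ) ^ 2)))
    refine (this.congr_deriv ?_).deriv
    simp
  rw [e] at h
  simp only [iteratedDeriv_succ, iteratedDeriv_zero, e1, e2, e3, e4] at h
  simpa using h.symm

section Dual

variable {F : Type*} [NormedAddCommGroup F] [NormedSpace ℝ F] [MeasurableSpace F] [BorelSpace F]
  (ν : Measure F) [IsGaussian ν]

theorem integral_dual_pow_four (L : StrongDual ℝ F) (hL : ∫ z, L z ∂ν = 0) :
    ∫ z, L z ^ 4 ∂ν = 3 * (∫ z, L z ^ 2 ∂ν) ^ 2 := by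
  have h := IsGaussian.map_eq_gaussianReal (μ := ν) L
  have hv : Var[L; ν] = ∫ z, L z ^ 2 ∂ν := by
    rw [variance_of_integral_eq_zero (by fun_prop) hL]
  have h4 : ∫ z, L z ^ 4 ∂ν = ∫ x, x ^ 4 ∂(ν.map L) := by
    rw [integral_map (by fun_prop) (by fun_prop)]
  rw [h4, h, hL, integral_pow_four_gaussianReal, Real.coe_toNNReal _ (variance_nonneg _ _), hv]

theorem integrable_dual_pow_four (L : StrongDual ℝ F) : Integrable (fun z => L z ^ 4) ν := by
  have := (IsGaussian.memLp_dual ν L 4 (by simp)).integrable_norm_pow (p := 4) (by norm_num)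
  refine this.congr (ae_of_all _ fun z => ?_)
  simp only [Real.norm_eq_abs]
  exact (Even.pow_abs (by decide) _)

theorem integrable_dual_mul (L M : StrongDual ℝ F) : Integrable (fun z => L z * M z) ν :=
  (IsGaussian.memLp_dual ν L 2 (by simp)).integrable_mul (IsGaussian.memLp_dual ν M 2 (by simp))

/-- Weighting `(a ± b ± c ± d)^4` by the product of its signs kills every monomial except `abcd`,
which survives with coefficient `8 · 4! = 192`. Statements on fourth powers of functionals thus pass
to products of four. -/
theorem dual_prod_polarization (a b c d : ℝ) :
    a * b * c * d = (1 / 192) * ((a + b + c + d) ^ 4 - (a + b + c - d) ^ 4 - (a + b - c + d) ^ 4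
      + (a + b - c - d) ^ 4 - (a - b + c + d) ^ 4 + (a - b + c - d) ^ 4 + (a - b - c + d) ^ 4
      - (a - b - c - d) ^ 4) := by
  ring

theorem integrable_dual_mul_four (L₁ L₂ L₃ L₄ : StrongDual ℝ F) :
    Integrable (fun z => L₁ z * L₂ z * L₃ z * L₄ z) ν := by
  simp_rw [dual_prod_polarization]
  have I := integrable_dual_pow_four ν
  exact ((((((((I (L₁ + L₂ + L₃ + L₄)).sub (I (L₁ + L₂ + L₃ - L₄))).sub
    (I (L₁ + L₂ - L₃ + L₄))).add (I (L₁ + L₂ - L₃ - L₄))).sub (I (L₁ - L₂ + L₃ + L₄))).add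
    (I (L₁ - L₂ + L₃ - L₄))).add (I (L₁ - L₂ - L₃ + L₄))).sub (I (L₁ - L₂ - L₃ - L₄))).const_mul _

theorem integral_dual_sq_comb (L₁ L₂ L₃ L₄ : StrongDual ℝ F) (b c d : ℝ) :
    ∫ z, (L₁ z + b * L₂ z + c * L₃ z + d * L₄ z) ^ 2 ∂ν =
      (∫ z, L₁ z * L₁ z ∂ν) + b ^ 2 * (∫ z, L₂ z * L₂ z ∂ν) + c ^ 2 * (∫ z, L₃ z * L₃ z ∂ν)
      + d ^ 2 * (∫ z, L₄ z * L₄ z ∂ν) + 2 * b * (∫ z, L₁ z * L₂ z ∂ν)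
      + 2 * c * (∫ z, L₁ z * L₃ z ∂ν) + 2 * d * (∫ z, L₁ z * L₄ z ∂ν)
      + 2 * b * c * (∫ z, L₂ z * L₃ z ∂ν) + 2 * b * d * (∫ z, L₂ z * L₄ z ∂ν)
      + 2 * c * d * (∫ z, L₃ z * L₄ z ∂ν) := by
  have I := integrable_dual_mul ν
  simp_rw [← integral_const_mul]
  repeat rw [← integral_add (by fun_prop (disch := apply I)) (by fun_prop (disch := apply I))]
  congr 1
  funext z
  ring

/-- Isserlis' formula for four centered continuous linear functionals of a Gaussian measure. -/
theorem integral_dual_mul_four (L₁ L₂ L₃ L₄ : StrongDual ℝ F) (h₁ : ∫ z, L₁ z ∂ν = 0)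
    (h₂ : ∫ z, L₂ z ∂ν = 0) (h₃ : ∫ z, L₃ z ∂ν = 0) (h₄ : ∫ z, L₄ z ∂ν = 0) :
    ∫ z, L₁ z * L₂ z * L₃ z * L₄ z ∂ν =
      (∫ z, L₁ z * L₂ z ∂ν) * (∫ z, L₃ z * L₄ z ∂ν)
      + (∫ z, L₁ z * L₃ z ∂ν) * (∫ z, L₂ z * L₄ z ∂ν)
      + (∫ z, L₁ z * L₄ z ∂ν) * (∫ z, L₂ z * L₃ z ∂ν) := by
  -- Every linear combination is again a centered functional, so its fourth moment is three times
  -- its squared variance; polarization then leaves a polynomial identity in the pairwise second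
  -- moments.
  have key : ∀ b c d : ℝ, Integrable (fun z => (L₁ z + b * L₂ z + c * L₃ z + d * L₄ z) ^ 4) ν ∧
      ∫ z, (L₁ z + b * L₂ z + c * L₃ z + d * L₄ z) ^ 4 ∂ν =
      3 * (∫ z, (L₁ z + b * L₂ z + c * L₃ z + d * L₄ z) ^ 2 ∂ν) ^ 2 := by
    intro b c d
    have I : ∀ L : StrongDual ℝ F, Integrable (fun z => L z) ν := fun L =>
      IsGaussian.integrable_dual ν L
    have hL : ∫ z, (L₁ + b • L₂ + c • L₃ + d • L₄) z ∂ν = 0 := by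
      simp only [add_apply, smul_apply, smul_eq_mul]
      rw [integral_add (by fun_prop (disch := apply I)) (by fun_prop (disch := apply I)),
        integral_add (by fun_prop (disch := apply I)) (by fun_prop (disch := apply I)),
        integral_add (by fun_prop (disch := apply I)) (by fun_prop (disch := apply I))]
      simp [integral_const_mul, h₁, h₂, h₃, h₄]
    exact ⟨integrable_dual_pow_four ν (L₁ + b • L₂ + c • L₃ + d • L₄),
      integral_dual_pow_four ν _ hL⟩
  have e : ∀ z, L₁ z * L₂ z * L₃ z * L₄ z = (1 / 192) *
      ((L₁ z + 1 * L₂ z + 1 * L₃ z + 1 * L₄ z) ^ 4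
      - (L₁ z + 1 * L₂ z + 1 * L₃ z + (-1) * L₄ z) ^ 4
      - (L₁ z + 1 * L₂ z + (-1) * L₃ z + 1 * L₄ z) ^ 4
      + (L₁ z + 1 * L₂ z + (-1) * L₃ z + (-1) * L₄ z) ^ 4
      - (L₁ z + (-1) * L₂ z + 1 * L₃ z + 1 * L₄ z) ^ 4
      + (L₁ z + (-1) * L₂ z + 1 * L₃ z + (-1) * L₄ z) ^ 4
      + (L₁ z + (-1) * L₂ z + (-1) * L₃ z + 1 * L₄ z) ^ 4
      - (L₁ z + (-1) * L₂ z + (-1) * L₃ z + (-1) * L₄ z) ^ 4) := fun z => by ring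
  -- `s` and `p` carry integrability along with the value, so the eight-term signed sum is
  -- integrated by nesting them.
  have s : ∀ {f g : F → ℝ} {a b : ℝ}, Integrable f ν ∧ ∫ z, f z ∂ν = a →
      Integrable g ν ∧ ∫ z, g z ∂ν = b →
      Integrable (fun z => f z - g z) ν ∧ ∫ z, (f z - g z) ∂ν = a - b := fun hf hg =>
    ⟨hf.1.sub hg.1, by rw [integral_sub hf.1 hg.1, hf.2, hg.2]⟩
  have p : ∀ {f g : F → ℝ} {a b : ℝ}, Integrable f ν ∧ ∫ z, f z ∂ν = a →
      Integrable g ν ∧ ∫ z, g z ∂ν = b →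
      Integrable (fun z => f z + g z) ν ∧ ∫ z, (f z + g z) ∂ν = a + b := fun hf hg =>
    ⟨hf.1.add hg.1, by rw [integral_add hf.1 hg.1, hf.2, hg.2]⟩
  simp_rw [e]
  rw [integral_const_mul, (s (p (p (s (p (s (s (key 1 1 1) (key 1 1 (-1))) (key 1 (-1) 1))
    (key 1 (-1) (-1))) (key (-1) 1 1)) (key (-1) 1 (-1))) (key (-1) (-1) 1))
    (key (-1) (-1) (-1))).2]
  simp only [integral_dual_sq_comb]
  ring

end Dual

/-! ### Moments of the sample mean and of the sample covariance of a Gaussian sample -/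

section Sample

variable {p N : ℕ} (μ : EuclideanSpace ℝ (Fin p)) (S : Matrix (Fin p) (Fin p) ℝ)

/-- Independent Gaussian points are jointly Gaussian. Coordinates, sample means and deviations
thereby all become continuous linear functionals of a single Gaussian measure. -/
instance isGaussian_gaussianSample : IsGaussian (gaussianSample N μ S) := by
  have h : HasGaussianLaw (fun (z : Fin N → EuclideanSpace ℝ (Fin p)) i => z i)
      (gaussianSample N μ S) := by
    have hi : iIndepFun (fun i (z : Fin N → EuclideanSpace ℝ (Fin p)) => z i)
        (gaussianSample N μ S) := iIndepFun_pi (X := fun _ => id) fun _ => aemeasurable_id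
    refine iIndepFun.hasGaussianLaw (fun i => ⟨?_⟩) hi
    have : (gaussianSample N μ S).map (fun z => z i) = multivariateGaussian μ S :=
      (measurePreserving_eval (fun _ : Fin N => multivariateGaussian μ S) i).map_eq
    rw [this]
    infer_instance
  simpa using h.isGaussian_map

noncomputable section

/-- The continuous linear functional reading coordinate `a` of the point `z i`. -/
def coordDual (i : Fin N) (a : Fin p) : StrongDual ℝ (Fin N → EuclideanSpace ℝ (Fin p)) :=
  (EuclideanSpace.proj (𝕜 := ℝ) a).comp (ContinuousLinearMap.proj i)

/-- The continuous linear functional reading coordinate `a` of the sample mean. -/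
def meanDual (a : Fin p) : StrongDual ℝ (Fin N → EuclideanSpace ℝ (Fin p)) :=
  ∑ i, (N : ℝ)⁻¹ • coordDual i a

/-- The continuous linear functional reading coordinate `a` of the deviation of `z i` from the
sample mean. -/
def devDual (i : Fin N) (a : Fin p) : StrongDual ℝ (Fin N → EuclideanSpace ℝ (Fin p)) :=
  coordDual i a - meanDual a

end

theorem coordDual_apply (i : Fin N) (a : Fin p) (z : Fin N → EuclideanSpace ℝ (Fin p)) :
    coordDual i a z = z i a := rfl

theorem meanDual_apply_eq_sum (a : Fin p) (z : Fin N → EuclideanSpace ℝ (Fin p)) :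
    meanDual a z = ∑ i, (N : ℝ)⁻¹ * coordDual i a z := by
  simp [meanDual]

theorem meanDual_apply (a : Fin p) (z : Fin N → EuclideanSpace ℝ (Fin p)) :
    meanDual a z = sampleMean z a := by
  simp [meanDual_apply_eq_sum, sampleMean, coordDual_apply, Finset.mul_sum]

theorem devDual_apply (i : Fin N) (a : Fin p) (z : Fin N → EuclideanSpace ℝ (Fin p)) :
    devDual i a z = coordDual i a z - meanDual a z := rfl

/-- Each entry is quadratic in centered functionals, so a product of two entries is accessible to
Isserlis' formula. -/
theorem sampleCov_apply (a b : Fin p) (z : Fin N → EuclideanSpace ℝ (Fin p)) :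
    sampleCov z a b = ((N : ℝ) - 1)⁻¹ * ∑ i, devDual i a z * devDual i b z := by
  simp [sampleCov, devDual_apply, meanDual_apply, coordDual_apply, Matrix.sum_apply,
    Matrix.vecMulVec_apply]

theorem integral_coordDual (i : Fin N) (a : Fin p) :
    ∫ z, coordDual i a z ∂gaussianSample N μ S = μ a := by
  have h1 : ∫ z, coordDual i a z ∂gaussianSample N μ S = ∫ u, u a ∂multivariateGaussian μ S := by
    rw [← (measurePreserving_eval (fun _ : Fin N => multivariateGaussian μ S) i).map_eq,
      integral_map (measurable_pi_apply i).aemeasurable (Measurable.aestronglyMeasurable (by fun_prop))]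
    rfl
  rw [h1]
  have := (EuclideanSpace.proj (𝕜 := ℝ) a).integral_comp_comm
    (IsGaussian.integrable_fun_id (μ := multivariateGaussian μ S))
  simpa using this

variable {S}

theorem covariance_coordDual (hS : S.PosSemidef) (i j : Fin N) (a b : Fin p) :
    cov[fun z => coordDual i a z, fun z => coordDual j b z; gaussianSample N μ S] =
      if i = j then S a b else 0 := by
  by_cases hij : i = j
  · subst hij
    have h : (gaussianSample N μ S).map (Function.eval i) = multivariateGaussian μ S :=
      (measurePreserving_eval (fun _ : Fin N => multivariateGaussian μ S) i).map_eq
    have h2 := covariance_map_fun (X := fun u : EuclideanSpace ℝ (Fin p) => u a)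
      (Y := fun u => u b) (Z := Function.eval i) (μ := gaussianSample N μ S)
      (Measurable.aestronglyMeasurable (by fun_prop))
      (Measurable.aestronglyMeasurable (by fun_prop)) (measurable_pi_apply i).aemeasurable
    rw [if_pos rfl, ← covariance_eval_multivariateGaussian (μ := μ) hS a b, ← h]
    exact h2.symm
  · have h : iIndepFun (fun i (z : Fin N → EuclideanSpace ℝ (Fin p)) => z i)
        (gaussianSample N μ S) := iIndepFun_pi (X := fun _ => id) fun _ => aemeasurable_id
    have h2 := (h.indepFun hij).comp (φ := fun u => u a) (ψ := fun u => u b)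
      (by fun_prop) (by fun_prop)
    rw [if_neg hij]
    exact h2.covariance_eq_zero (IsGaussian.memLp_dual _ (coordDual i a) 2 (by simp))
      (IsGaussian.memLp_dual _ (coordDual j b) 2 (by simp))

theorem memLp_two_dual (L : StrongDual ℝ (Fin N → EuclideanSpace ℝ (Fin p))) :
    MemLp (fun z => L z) 2 (gaussianSample N μ S) :=
  IsGaussian.memLp_dual _ L 2 (by simp)

theorem covariance_coordDual_meanDual (hS : S.PosSemidef) (i : Fin N) (a b : Fin p) :
    cov[fun z => coordDual i a z, fun z => meanDual b z; gaussianSample N μ S] =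
      (N : ℝ)⁻¹ * S a b := by
  simp_rw [meanDual_apply_eq_sum]
  rw [covariance_fun_sum_right (fun j => (memLp_two_dual μ (coordDual j b)).const_mul _)
    (memLp_two_dual μ _)]
  simp [covariance_const_mul_right, covariance_coordDual μ hS]

theorem covariance_meanDual (hS : S.PosSemidef) (hN : N ≠ 0) (a b : Fin p) :
    cov[fun z => meanDual a z, fun z => meanDual b z; gaussianSample N μ S] =
      (N : ℝ)⁻¹ * S a b := by
  have : (fun z : Fin N → EuclideanSpace ℝ (Fin p) => meanDual a z) =
    fun z => ∑ i, (N : ℝ)⁻¹ * coordDual i a z := funext (meanDual_apply_eq_sum a)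
  rw [this, covariance_fun_sum_left (fun j => (memLp_two_dual μ (coordDual j a)).const_mul _)
    (memLp_two_dual μ _)]
  simp [covariance_const_mul_left, covariance_coordDual_meanDual μ hS, hN]

theorem integral_meanDual (hN : N ≠ 0) (a : Fin p) :
    ∫ z, meanDual a z ∂gaussianSample N μ S = μ a := by
  simp_rw [meanDual_apply_eq_sum]
  rw [integral_finsetSum _ fun i _ => (IsGaussian.integrable_dual _ (coordDual i a)).const_mul _]
  simp [integral_const_mul, integral_coordDual, hN]

theorem integral_devDual (hN : N ≠ 0) (i : Fin N) (a : Fin p) :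
    ∫ z, devDual i a z ∂gaussianSample N μ S = 0 := by
  simp_rw [devDual_apply]
  rw [integral_sub (IsGaussian.integrable_dual _ _) (IsGaussian.integrable_dual _ _),
    integral_coordDual, integral_meanDual μ hN, sub_self]

theorem _root_.Matrix.PosSemidef.apply_comm (hS : S.PosSemidef) (a b : Fin p) : S a b = S b a := by
  simpa using (hS.isHermitian.apply a b).symm

/-- The scalar factor is the `(i, j)` entry of the centering projection `I - 11ᵀ/N`. -/
theorem integral_devDual_mul (hS : S.PosSemidef) (hN : N ≠ 0) (i j : Fin N) (a b : Fin p) :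
    ∫ z, devDual i a z * devDual j b z ∂gaussianSample N μ S =
      ((if i = j then 1 else 0) - (N : ℝ)⁻¹) * S a b := by
  have h := covariance_eq_sub (memLp_two_dual (S := S) μ (devDual i a))
    (memLp_two_dual μ (devDual j b))
  rw [integral_devDual μ hN, zero_mul, sub_zero] at h
  refine h.symm.trans ?_
  simp_rw [devDual_apply]
  rw [covariance_fun_sub_fun_sub (memLp_two_dual μ _) (memLp_two_dual μ _) (memLp_two_dual μ _)
    (memLp_two_dual μ _), covariance_coordDual μ hS, covariance_coordDual_meanDual μ hS,
    covariance_meanDual μ hS hN, covariance_comm, covariance_coordDual_meanDual μ hS,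
    hS.apply_comm b a]
  split_ifs <;> ring

theorem integrable_sampleMean (a : Fin p) :
    Integrable (fun z => sampleMean z a) (gaussianSample N μ S) := by
  simp_rw [← meanDual_apply]
  exact IsGaussian.integrable_dual _ _

theorem integrable_sampleMean_mul (a b : Fin p) :
    Integrable (fun z => sampleMean z a * sampleMean z b) (gaussianSample N μ S) := by
  simp_rw [← meanDual_apply]
  exact integrable_dual_mul _ _ _

theorem integral_sampleMean (hN : N ≠ 0) (a : Fin p) :
    ∫ z, sampleMean z a ∂gaussianSample N μ S = μ a := by
  simp_rw [← meanDual_apply]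
  exact integral_meanDual μ hN a

theorem integral_sampleMean_mul (hS : S.PosSemidef) (hN : N ≠ 0) (a b : Fin p) :
    ∫ z, sampleMean z a * sampleMean z b ∂gaussianSample N μ S = μ a * μ b + (N : ℝ)⁻¹ * S a b := by
  have h := covariance_eq_sub (memLp_two_dual (S := S) (N := N) μ (meanDual a))
    (memLp_two_dual μ (meanDual b))
  rw [covariance_meanDual μ hS hN, integral_meanDual μ hN, integral_meanDual μ hN] at h
  simp_rw [← meanDual_apply]
  have h' : (gaussianSample N μ S)[fun z => meanDual a z * meanDual b z] =
      μ a * μ b + (N : ℝ)⁻¹ * S a b := by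
    rw [h]
    simp
  exact h'

theorem integrable_sampleCov (a b : Fin p) :
    Integrable (fun z => sampleCov z a b) (gaussianSample N μ S) := by
  simp_rw [sampleCov_apply]
  exact (integrable_finsetSum _ fun i _ => integrable_dual_mul _ _ _).const_mul _

theorem integral_sampleCov (hS : S.PosSemidef) (hN : 2 ≤ N) (a b : Fin p) :
    ∫ z, sampleCov z a b ∂gaussianSample N μ S = S a b := by
  have hN0 : (N : ℝ) ≠ 0 := by positivity
  have hN1 : (N : ℝ) - 1 ≠ 0 := by
    have : (2 : ℝ) ≤ N := by exact_mod_cast hN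
    linarith
  simp_rw [sampleCov_apply]
  rw [integral_const_mul, integral_finsetSum _ fun i _ => integrable_dual_mul _ _ _]
  simp_rw [integral_devDual_mul μ hS (by omega : N ≠ 0)]
  simp
  field_simp

theorem sampleCov_mul_apply (a b c d : Fin p) (z : Fin N → EuclideanSpace ℝ (Fin p)) :
    sampleCov z a b * sampleCov z c d = (((N : ℝ) - 1)⁻¹ * ((N : ℝ) - 1)⁻¹) *
      ∑ i, ∑ j, devDual i a z * devDual i b z * devDual j c z * devDual j d z := by
  rw [sampleCov_apply, sampleCov_apply, mul_mul_mul_comm, Finset.sum_mul_sum]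
  simp_rw [mul_assoc]

theorem integrable_sampleCov_mul (a b c d : Fin p) :
    Integrable (fun z => sampleCov z a b * sampleCov z c d) (gaussianSample N μ S) := by
  simp_rw [sampleCov_mul_apply]
  exact (integrable_finsetSum _ fun i _ => integrable_finsetSum _ fun j _ =>
    integrable_dual_mul_four _ _ _ _ _).const_mul _

/-- The squared Frobenius norm of an orthogonal projection is its rank, here `N - 1`. -/
theorem sum_centering_sq (hN : N ≠ 0) :
    ∑ i : Fin N, ∑ j : Fin N, ((if i = j then (1 : ℝ) else 0) - (N : ℝ)⁻¹) ^ 2 = N - 1 := by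
  have hN0 : (N : ℝ) ≠ 0 := by exact_mod_cast hN
  have : ∀ i j : Fin N, ((if i = j then (1 : ℝ) else 0) - (N : ℝ)⁻¹) ^ 2 =
      (if i = j then 1 - 2 * (N : ℝ)⁻¹ else 0) + (N : ℝ)⁻¹ ^ 2 := by
    intro i j
    split_ifs <;> ring
  simp_rw [this, Finset.sum_add_distrib]
  simp
  field_simp
  ring

/-- In Isserlis' formula the pairing inside each entry contributes `(1 - 1/N)²` for every `(i, j)`,
in total `(N-1)²`; each cross pairing contributes the squared centering entries, in total `N - 1`.
Dividing by `(N-1)²` gives the formula. -/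
theorem integral_sampleCov_mul (hS : S.PosSemidef) (hN : 2 ≤ N) (a b c d : Fin p) :
    ∫ z, sampleCov z a b * sampleCov z c d ∂gaussianSample N μ S =
      S a b * S c d + ((N : ℝ) - 1)⁻¹ * (S a c * S b d + S a d * S b c) := by
  have hN' : N ≠ 0 := by omega
  have hN0 : (N : ℝ) ≠ 0 := by positivity
  have hN1 : (N : ℝ) - 1 ≠ 0 := by
    have : (2 : ℝ) ≤ N := by exact_mod_cast hN
    linarith
  have key : ∀ i j : Fin N,
      ∫ z, devDual i a z * devDual i b z * devDual j c z * devDual j d z ∂gaussianSample N μ S =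
      (1 - (N : ℝ)⁻¹) ^ 2 * (S a b * S c d) + ((if i = j then (1 : ℝ) else 0) - (N : ℝ)⁻¹) ^ 2 *
        (S a c * S b d + S a d * S b c) := by
    intro i j
    have h0 := integral_devDual (S := S) μ hN'
    rw [integral_dual_mul_four _ _ _ _ _ (h0 i a) (h0 i b) (h0 j c) (h0 j d)]
    simp_rw [integral_devDual_mul μ hS hN']
    simp only [if_true]
    ring
  simp_rw [sampleCov_mul_apply]
  rw [integral_const_mul, integral_finsetSum _ fun i _ => integrable_finsetSum _ fun j _ =>
    integrable_dual_mul_four _ _ _ _ _]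
  simp_rw [integral_finsetSum Finset.univ fun j _ => integrable_dual_mul_four _ _ _ _ _, key,
    Finset.sum_add_distrib, ← Finset.sum_mul, sum_centering_sq hN']
  simp
  field_simp

end Sample

/-! ### Integration of a random variable through its conditional law -/

section Disintegration

variable {Ω α : Type*} {H mΩ : MeasurableSpace Ω} [MeasurableSpace α] {P : Measure Ω}
  [IsProbabilityMeasure P] {X : Ω → α} {κ : Ω → Measure α}
  [∀ ω, IsProbabilityMeasure (κ ω)]

/-- The family `κ` is not assumed to be a kernel. Almost everywhere measurability of `κ · B` comes
from its agreement with a conditional expectation, and is therefore carried through the induction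
from indicators to general `f`. -/
theorem lintegral_eq_lintegral_condLaw (hH : H ≤ mΩ) (hX : Measurable X)
    (hκ : ∀ B, MeasurableSet B → P⟦{ω | X ω ∈ B} | H⟧ =ᵐ[P] fun ω => (κ ω).real B)
    {f : α → ℝ≥0∞} (hf : Measurable f) :
    AEMeasurable (fun ω => ∫⁻ u, f u ∂κ ω) P ∧
      ∫⁻ ω, f (X ω) ∂P = ∫⁻ ω, ∫⁻ u, f u ∂κ ω ∂P := by
  have hB : ∀ B, MeasurableSet B → AEMeasurable (fun ω => κ ω B) P ∧
      P (X ⁻¹' B) = ∫⁻ ω, κ ω B ∂P := by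
    intro B hB
    have hreal : AEStronglyMeasurable (fun ω => (κ ω).real B) P :=
      (integrable_condExp.aestronglyMeasurable).congr (hκ B hB)
    have hofReal : ∀ ω, κ ω B = ENNReal.ofReal ((κ ω).real B) := fun ω => by simp
    refine ⟨?_, ?_⟩
    · simp_rw [hofReal]
      exact hreal.aemeasurable.ennreal_ofReal
    · have h1 : ∫ ω, (κ ω).real B ∂P = P.real (X ⁻¹' B) := by
        rw [← integral_congr_ae (hκ B hB), integral_condExp hH]
        have := integral_indicator_one (μ := P) (hX hB)
        exact this
      simp_rw [hofReal]
      rw [← ofReal_integral_eq_lintegral_ofReal (integrable_condExp.congr (hκ B hB))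
        (ae_of_all _ fun ω => measureReal_nonneg), h1]
      simp
  refine Measurable.ennreal_induction (motive := fun f =>
    AEMeasurable (fun ω => ∫⁻ u, f u ∂κ ω) P ∧
      ∫⁻ ω, f (X ω) ∂P = ∫⁻ ω, ∫⁻ u, f u ∂κ ω ∂P) ?_ ?_ ?_ hf
  · intro c s hs
    have e : ∀ ω, ∫⁻ u, s.indicator (fun _ => c) u ∂κ ω = c * κ ω s := fun ω => by
      rw [lintegral_indicator_const hs]
    simp_rw [e]
    refine ⟨(hB s hs).1.const_mul c, ?_⟩
    rw [lintegral_const_mul'' _ (hB s hs).1, ← (hB s hs).2]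
    exact lintegral_indicator_const (hX hs) c
  · intro f g _ hf hg hf' hg'
    have e : ∀ ω, ∫⁻ u, (f + g) u ∂κ ω = ∫⁻ u, f u ∂κ ω + ∫⁻ u, g u ∂κ ω := fun ω =>
      lintegral_add_left hf _
    simp_rw [e]
    refine ⟨hf'.1.add hg'.1, ?_⟩
    rw [lintegral_add_left' hf'.1, ← hf'.2, ← hg'.2]
    exact lintegral_add_left (hf.comp hX) _
  · intro f hf hmono h
    have e : ∀ ω, ∫⁻ u, ⨆ k, f k u ∂κ ω = ⨆ k, ∫⁻ u, f k u ∂κ ω := fun ω =>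
      lintegral_iSup hf hmono
    simp_rw [e]
    refine ⟨AEMeasurable.iSup fun k => (h k).1, ?_⟩
    rw [lintegral_iSup (f := fun k ω => f k (X ω)) (fun k => (hf k).comp hX) (fun i j hij ω => hmono hij (X ω)),
      lintegral_iSup' (fun k => (h k).1)
        (ae_of_all _ fun ω i j hij => lintegral_mono (hmono hij))]
    exact iSup_congr fun k => (h k).2

theorem integral_eq_integral_condLaw_of_nonneg (hH : H ≤ mΩ) (hX : Measurable X)
    (hκ : ∀ B, MeasurableSet B → P⟦{ω | X ω ∈ B} | H⟧ =ᵐ[P] fun ω => (κ ω).real B)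
    {f : α → ℝ} {g : Ω → ℝ} (hf : Measurable f) (hf0 : ∀ u, 0 ≤ f u)
    (hfκ : ∀ ω, Integrable f (κ ω)) (hfg : ∀ ω, ∫ u, f u ∂κ ω = g ω) (hg : Integrable g P) :
    Integrable (fun ω => f (X ω)) P ∧ ∫ ω, f (X ω) ∂P = ∫ ω, g ω ∂P := by
  have hg0 : ∀ ω, 0 ≤ g ω := fun ω => by rw [← hfg]; exact integral_nonneg hf0
  have h := (lintegral_eq_lintegral_condLaw hH hX hκ (f := fun u => ENNReal.ofReal (f u))
    hf.ennreal_ofReal).2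
  have e : ∀ ω, ∫⁻ u, ENNReal.ofReal (f u) ∂κ ω = ENNReal.ofReal (g ω) := fun ω => by
    rw [← hfg, ofReal_integral_eq_lintegral_ofReal (hfκ ω) (ae_of_all _ hf0)]
  simp_rw [e] at h
  rw [← ofReal_integral_eq_lintegral_ofReal hg (ae_of_all _ hg0)] at h
  have hm : AEStronglyMeasurable (fun ω => f (X ω)) P :=
    (hf.comp hX).aestronglyMeasurable
  refine ⟨⟨hm, ?_⟩, ?_⟩
  · rw [hasFiniteIntegral_iff_ofReal (ae_of_all _ fun ω => hf0 _), h]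
    exact ENNReal.ofReal_lt_top
  · rw [integral_eq_lintegral_of_nonneg_ae (ae_of_all _ fun ω => hf0 _) hm, h,
      ENNReal.toReal_ofReal (integral_nonneg hg0)]

/-- Since `|f| ≤ h`, both `h` and `h + f` are nonnegative, and the signed case follows by
subtraction. -/
theorem integral_eq_integral_condLaw (hH : H ≤ mΩ) (hX : Measurable X)
    (hκ : ∀ B, MeasurableSet B → P⟦{ω | X ω ∈ B} | H⟧ =ᵐ[P] fun ω => (κ ω).real B)
    {f h : α → ℝ} {g k : Ω → ℝ} (hf : Measurable f) (hh : Measurable h) (hfh : ∀ u, |f u| ≤ h u)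
    (hfκ : ∀ ω, Integrable f (κ ω)) (hfg : ∀ ω, ∫ u, f u ∂κ ω = g ω) (hg : Integrable g P)
    (hhκ : ∀ ω, Integrable h (κ ω)) (hhk : ∀ ω, ∫ u, h u ∂κ ω = k ω) (hk : Integrable k P) :
    Integrable (fun ω => f (X ω)) P ∧ ∫ ω, f (X ω) ∂P = ∫ ω, g ω ∂P := by
  have h1 := integral_eq_integral_condLaw_of_nonneg hH hX hκ hh
    (fun u => (abs_nonneg _).trans (hfh u)) hhκ hhk hk
  have h2 := integral_eq_integral_condLaw_of_nonneg hH hX hκ (f := fun u => h u + f u)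
    (g := fun ω => k ω + g ω) (hh.add hf) (fun u => by linarith [neg_abs_le (f u), hfh u])
    (fun ω => (hhκ ω).add (hfκ ω))
    (fun ω => by rw [integral_add (hhκ ω) (hfκ ω), hfg, hhk]) (hk.add hg)
  have e : (fun ω => f (X ω)) = fun ω => (h (X ω) + f (X ω)) - h (X ω) := by
    funext ω; ring
  rw [e]
  refine ⟨h2.1.sub h1.1, ?_⟩
  rw [integral_sub h2.1 h1.1, h2.2, h1.2, integral_add hk hg]
  ring

end Disintegration

/-! ### Moments of one training step, conditionally on the past -/

section Mixture

variable {α β : Type*} [MeasurableSpace α] [MeasurableSpace β] (ρ : Measure α) (τ : Measure β)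
  [IsProbabilityMeasure ρ] [IsProbabilityMeasure τ] (w v : ℝ) {f g : α → ℝ} {h k : β → ℝ}

theorem integrable_mix (hf : Integrable f ρ) (hh : Integrable h τ) :
    Integrable (fun u => w * f u.1 + v * h u.2) (ρ.prod τ) :=
  ((hf.comp_fst τ).const_mul w).add ((hh.comp_snd ρ).const_mul v)

theorem integral_mix (hf : Integrable f ρ) (hh : Integrable h τ) :
    ∫ u, (w * f u.1 + v * h u.2) ∂ρ.prod τ = w * ∫ x, f x ∂ρ + v * ∫ y, h y ∂τ := by
  rw [integral_add ((hf.comp_fst τ).const_mul w) ((hh.comp_snd ρ).const_mul v),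
    integral_const_mul, integral_const_mul, integral_fun_fst, integral_fun_snd]
  simp

/-- Independence of the real and synthetic samples factors the cross terms. -/
theorem integral_mix_mul (hf : Integrable f ρ) (hg : Integrable g ρ) (hh : Integrable h τ)
    (hk : Integrable k τ) (hfg : Integrable (fun x => f x * g x) ρ)
    (hhk : Integrable (fun y => h y * k y) τ) :
    Integrable (fun u => (w * f u.1 + v * h u.2) * (w * g u.1 + v * k u.2)) (ρ.prod τ) ∧
    ∫ u, (w * f u.1 + v * h u.2) * (w * g u.1 + v * k u.2) ∂ρ.prod τ =
      w ^ 2 * ∫ x, f x * g x ∂ρ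
        + w * v * ((∫ x, f x ∂ρ) * (∫ y, k y ∂τ) + (∫ x, g x ∂ρ) * (∫ y, h y ∂τ))
        + v ^ 2 * ∫ y, h y * k y ∂τ := by
  have e : (fun u : α × β => (w * f u.1 + v * h u.2) * (w * g u.1 + v * k u.2)) =
      fun u => (w ^ 2 * (f u.1 * g u.1) + w * v * (f u.1 * k u.2 + g u.1 * h u.2))
        + v ^ 2 * (h u.2 * k u.2) := by
    funext u; ring
  have i1 : Integrable (fun u : α × β => w ^ 2 * (f u.1 * g u.1)) (ρ.prod τ) :=
    (hfg.comp_fst τ).const_mul _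
  have i2 : Integrable (fun u : α × β => f u.1 * k u.2) (ρ.prod τ) := hf.mul_prod hk
  have i3 : Integrable (fun u : α × β => g u.1 * h u.2) (ρ.prod τ) := hg.mul_prod hh
  have i4 : Integrable (fun u : α × β => v ^ 2 * (h u.2 * k u.2)) (ρ.prod τ) :=
    (hhk.comp_snd ρ).const_mul _
  have i5 : Integrable (fun u : α × β => w * v * (f u.1 * k u.2 + g u.1 * h u.2)) (ρ.prod τ) :=
    (i2.add i3).const_mul _
  have i6 : Integrable (fun u : α × β => w ^ 2 * (f u.1 * g u.1)
      + w * v * (f u.1 * k u.2 + g u.1 * h u.2)) (ρ.prod τ) := i1.add i5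
  rw [e]
  refine ⟨i6.add i4, ?_⟩
  rw [integral_add i6 i4, integral_add i1 i5,
    integral_const_mul, integral_const_mul, integral_const_mul, integral_add i2 i3,
    integral_prod_mul, integral_prod_mul, integral_fun_fst (fun x => f x * g x),
    integral_fun_snd (fun y => h y * k y)]
  simp

end Mixture

section Step

variable {p n m : ℕ}

noncomputable section

/-- The mean estimator trained on a real dataset `u.1` and a synthetic dataset `u.2`. -/
def mixMean (w : ℝ) (u : (Fin n → EuclideanSpace ℝ (Fin p)) × (Fin m → EuclideanSpace ℝ (Fin p))) :
    EuclideanSpace ℝ (Fin p) :=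
  w • sampleMean u.1 + (1 - w) • sampleMean u.2

/-- The covariance estimator trained on a real dataset `u.1` and a synthetic dataset `u.2`. -/
def mixCov (w : ℝ) (u : (Fin n → EuclideanSpace ℝ (Fin p)) × (Fin m → EuclideanSpace ℝ (Fin p))) :
    Matrix (Fin p) (Fin p) ℝ :=
  w • sampleCov u.1 + (1 - w) • sampleCov u.2

end

theorem measurable_sampleMean {N : ℕ} :
    Measurable (sampleMean : (Fin N → EuclideanSpace ℝ (Fin p)) → EuclideanSpace ℝ (Fin p)) := by
  unfold sampleMean
  fun_prop

theorem measurable_sampleCov_apply {N : ℕ} (a b : Fin p) :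
    Measurable (fun z : Fin N → EuclideanSpace ℝ (Fin p) => sampleCov z a b) := by
  simp_rw [sampleCov_apply]
  fun_prop

theorem measurable_mixMean (w : ℝ) : Measurable (mixMean (p := p) (n := n) (m := m) w) :=
  ((measurable_sampleMean.comp measurable_fst).const_smul w).add
    ((measurable_sampleMean.comp measurable_snd).const_smul (1 - w))

theorem mixCov_apply (w : ℝ)
    (u : (Fin n → EuclideanSpace ℝ (Fin p)) × (Fin m → EuclideanSpace ℝ (Fin p))) (a b : Fin p) :
    mixCov w u a b = w * sampleCov u.1 a b + (1 - w) * sampleCov u.2 a b := rfl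

theorem measurable_mixCov_apply (w : ℝ) (a b : Fin p) :
    Measurable (fun u => mixCov (n := n) (m := m) w u a b) :=
  (((measurable_sampleCov_apply a b).comp measurable_fst).const_mul w).add
    (((measurable_sampleCov_apply a b).comp measurable_snd).const_mul (1 - w))

theorem frobeniusSq_eq_trace {S : Matrix (Fin p) (Fin p) ℝ} (hS : S.PosSemidef) :
    frobeniusSq S = (S ^ 2).trace := by
  simp only [frobeniusSq, Matrix.trace, Matrix.diag, sq, Matrix.mul_apply]
  exact Finset.sum_congr rfl fun a _ => Finset.sum_congr rfl fun b _ => by rw [hS.apply_comm b a]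

theorem norm_sub_sq_eq_sum (a b : EuclideanSpace ℝ (Fin p)) :
    ‖a - b‖ ^ 2 = ∑ i, (a i - b i) ^ 2 := by
  simp [EuclideanSpace.real_norm_sq_eq]

section SampleErrors

variable {N : ℕ} (μ : EuclideanSpace ℝ (Fin p)) {S : Matrix (Fin p) (Fin p) ℝ}

theorem integrable_sampleMean_sub_sq (c : ℝ) (a : Fin p) :
    Integrable (fun z => (sampleMean z a - c) * (sampleMean z a - c)) (gaussianSample N μ S) := by
  have e : (fun z : Fin N → EuclideanSpace ℝ (Fin p) =>
      (sampleMean z a - c) * (sampleMean z a - c)) =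
      fun z => (sampleMean z a * sampleMean z a - (2 * c) * sampleMean z a) + c ^ 2 := by
    funext z; ring
  rw [e]
  exact ((integrable_sampleMean_mul μ a a).sub ((integrable_sampleMean μ a).const_mul _)).add
    (integrable_const _)

theorem integral_sampleMean_sub_sq (hS : S.PosSemidef) (hN : N ≠ 0) (c : ℝ) (a : Fin p) :
    ∫ z, (sampleMean z a - c) * (sampleMean z a - c) ∂gaussianSample N μ S =
      (N : ℝ)⁻¹ * S a a + (μ a - c) ^ 2 := by
  have e : (fun z : Fin N → EuclideanSpace ℝ (Fin p) =>
      (sampleMean z a - c) * (sampleMean z a - c)) =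
      fun z => (sampleMean z a * sampleMean z a - (2 * c) * sampleMean z a) + c ^ 2 := by
    funext z; ring
  have i : Integrable (fun z => sampleMean z a * sampleMean z a - (2 * c) * sampleMean z a)
      (gaussianSample N μ S) :=
    (integrable_sampleMean_mul μ a a).sub ((integrable_sampleMean μ a).const_mul _)
  rw [e, integral_add i (integrable_const _),
    integral_sub (integrable_sampleMean_mul μ a a) ((integrable_sampleMean μ a).const_mul _),
    integral_sampleMean_mul μ hS hN, integral_const_mul, integral_sampleMean μ hN]
  simp
  ring

theorem integral_norm_sampleMean_sub_sq (hS : S.PosSemidef) (hN : N ≠ 0) :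
    Integrable (fun z => ‖sampleMean z - μ‖ ^ 2) (gaussianSample N μ S) ∧
    ∫ z, ‖sampleMean z - μ‖ ^ 2 ∂gaussianSample N μ S = S.trace / N := by
  simp_rw [norm_sub_sq_eq_sum, sq]
  refine ⟨integrable_finsetSum _ fun a _ => integrable_sampleMean_sub_sq μ (μ a) a, ?_⟩
  rw [integral_finsetSum _ fun a _ => integrable_sampleMean_sub_sq μ (μ a) a]
  simp_rw [integral_sampleMean_sub_sq μ hS hN]
  simp [Matrix.trace, ← Finset.mul_sum]
  ring

/-- One cross pairing closes into the squared trace, the other into the Frobenius norm by symmetry.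
This is how the squared trace enters the Frobenius recursion. -/
theorem sum_isserlis_frobenius (hS : S.PosSemidef) (c : ℝ) :
    ∑ a, ∑ b, (S a b * S a b + c * (S a a * S b b + S a b * S b a)) =
      frobeniusSq S + c * (S.trace ^ 2 + frobeniusSq S) := by
  simp only [frobeniusSq, Matrix.trace, Matrix.diag, Finset.sum_add_distrib, ← Finset.mul_sum, sq,
    Finset.sum_mul_sum]
  congr 3
  exact Finset.sum_congr rfl fun a _ => Finset.sum_congr rfl fun b _ => by rw [hS.apply_comm b a]

/-- Here both cross pairings close into the Frobenius norm, hence the factor 2. No third quadratic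
statistic appears, so the system closes. -/
theorem sum_isserlis_trace (c : ℝ) :
    ∑ a, ∑ b, (S a a * S b b + c * (S a b * S a b + S a b * S a b)) =
      S.trace ^ 2 + 2 * c * frobeniusSq S := by
  simp only [frobeniusSq, Matrix.trace, Matrix.diag, Finset.sum_add_distrib, ← Finset.mul_sum, sq,
    Finset.sum_mul_sum]
  ring

theorem integral_frobeniusSq_sampleCov (hS : S.PosSemidef) (hN : 2 ≤ N) :
    Integrable (fun z => frobeniusSq (sampleCov z)) (gaussianSample N μ S) ∧
    ∫ z, frobeniusSq (sampleCov z) ∂gaussianSample N μ S =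
      frobeniusSq S + ((N : ℝ) - 1)⁻¹ * (S.trace ^ 2 + frobeniusSq S) := by
  rw [← sum_isserlis_frobenius hS]
  have I := integrable_sampleCov_mul (N := N) (S := S) μ
  have e : (fun z : Fin N → EuclideanSpace ℝ (Fin p) => frobeniusSq (sampleCov z)) =
      fun z => ∑ a, ∑ b, sampleCov z a b * sampleCov z a b := by
    funext z; simp_rw [frobeniusSq, sq]
  rw [e]
  refine ⟨integrable_finsetSum _ fun a _ => integrable_finsetSum _ fun b _ => I a b a b, ?_⟩
  rw [integral_finsetSum _ fun a _ => integrable_finsetSum _ fun b _ => I a b a b]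
  simp_rw [integral_finsetSum Finset.univ fun b _ => I _ b _ b, integral_sampleCov_mul μ hS hN]

theorem integral_trace_sq_sampleCov (hS : S.PosSemidef) (hN : 2 ≤ N) :
    Integrable (fun z => (sampleCov z).trace ^ 2) (gaussianSample N μ S) ∧
    ∫ z, (sampleCov z).trace ^ 2 ∂gaussianSample N μ S =
      S.trace ^ 2 + 2 * ((N : ℝ) - 1)⁻¹ * frobeniusSq S := by
  rw [← sum_isserlis_trace]
  have I := integrable_sampleCov_mul (N := N) (S := S) μ
  have e : (fun z : Fin N → EuclideanSpace ℝ (Fin p) => (sampleCov z).trace ^ 2) =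
      fun z => ∑ a, ∑ b, sampleCov z a a * sampleCov z b b := by
    funext z; simp_rw [Matrix.trace, Matrix.diag, sq, Finset.sum_mul_sum]
  rw [e]
  refine ⟨integrable_finsetSum _ fun a _ => integrable_finsetSum _ fun b _ => I a a b b, ?_⟩
  rw [integral_finsetSum _ fun a _ => integrable_finsetSum _ fun b _ => I a a b b]
  simp_rw [integral_finsetSum Finset.univ fun b _ => I _ _ b b, integral_sampleCov_mul μ hS hN]

end SampleErrors

variable (w : ℝ) (μ μ' : EuclideanSpace ℝ (Fin p)) {S S' : Matrix (Fin p) (Fin p) ℝ}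

theorem integral_norm_mixMean_sub_sq (hS : S.PosSemidef) (hS' : S'.PosSemidef) (hn : n ≠ 0)
    (hm : m ≠ 0) :
    Integrable (fun u => ‖mixMean w u - μ‖ ^ 2)
      ((gaussianSample n μ S).prod (gaussianSample m μ' S')) ∧
    ∫ u, ‖mixMean w u - μ‖ ^ 2 ∂(gaussianSample n μ S).prod (gaussianSample m μ' S') =
      w ^ 2 * (S.trace / n) + (1 - w) ^ 2 * (S'.trace / m + ‖μ' - μ‖ ^ 2) := by
  have key := fun a : Fin p => integral_mix_mul (gaussianSample n μ S) (gaussianSample m μ' S') w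
    (1 - w) (f := fun z => sampleMean z a - μ a) (g := fun z => sampleMean z a - μ a)
    (h := fun z => sampleMean z a - μ a) (k := fun z => sampleMean z a - μ a)
    ((integrable_sampleMean μ a).sub (integrable_const _))
    ((integrable_sampleMean μ a).sub (integrable_const _))
    ((integrable_sampleMean μ' a).sub (integrable_const _))
    ((integrable_sampleMean μ' a).sub (integrable_const _))
    (integrable_sampleMean_sub_sq μ _ a) (integrable_sampleMean_sub_sq μ' _ a)
  have e : (fun u : (Fin n → EuclideanSpace ℝ (Fin p)) × (Fin m → EuclideanSpace ℝ (Fin p)) =>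
      ‖mixMean w u - μ‖ ^ 2) = fun u => ∑ a,
        (w * (sampleMean u.1 a - μ a) + (1 - w) * (sampleMean u.2 a - μ a)) *
        (w * (sampleMean u.1 a - μ a) + (1 - w) * (sampleMean u.2 a - μ a)) := by
    funext u
    rw [norm_sub_sq_eq_sum]
    refine Finset.sum_congr rfl fun a _ => ?_
    simp only [mixMean, PiLp.add_apply, PiLp.smul_apply, smul_eq_mul]
    ring
  rw [e]
  refine ⟨integrable_finsetSum _ fun a _ => (key a).1, ?_⟩
  rw [integral_finsetSum _ fun a _ => (key a).1]
  -- The real deviation is centered, which kills the cross term; the synthetic one keeps the bias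
  -- `μ' - μ`.
  have h0 : ∀ a, ∫ z, (sampleMean z a - μ a) ∂gaussianSample n μ S = 0 := fun a => by
    rw [integral_sub (integrable_sampleMean μ a) (integrable_const _), integral_sampleMean μ hn]
    simp
  simp_rw [fun a => (key a).2, h0, integral_sampleMean_sub_sq μ hS hn,
    integral_sampleMean_sub_sq μ' hS' hm, norm_sub_sq_eq_sum]
  simp only [Matrix.trace, Matrix.diag, Finset.sum_add_distrib, ← Finset.mul_sum]
  simp
  ring

theorem integral_mixCov (hS : S.PosSemidef) (hS' : S'.PosSemidef) (hn : 2 ≤ n) (hm : 2 ≤ m)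
    (a b : Fin p) :
    Integrable (fun u => mixCov w u a b)
      ((gaussianSample n μ S).prod (gaussianSample m μ' S')) ∧
    ∫ u, mixCov w u a b ∂(gaussianSample n μ S).prod (gaussianSample m μ' S') =
      w * S a b + (1 - w) * S' a b := by
  simp_rw [mixCov_apply]
  refine ⟨integrable_mix _ _ _ _ (integrable_sampleCov μ a b) (integrable_sampleCov μ' a b), ?_⟩
  rw [integral_mix _ _ _ _ (integrable_sampleCov μ a b) (integrable_sampleCov μ' a b),
    integral_sampleCov μ hS hn, integral_sampleCov μ' hS' hm]

theorem integral_frobeniusSq_mixCov (hS : S.PosSemidef) (hS' : S'.PosSemidef) (hn : 2 ≤ n)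
    (hm : 2 ≤ m) :
    Integrable (fun u => frobeniusSq (mixCov w u))
      ((gaussianSample n μ S).prod (gaussianSample m μ' S')) ∧
    ∫ u, frobeniusSq (mixCov w u) ∂(gaussianSample n μ S).prod (gaussianSample m μ' S') =
      w ^ 2 * (frobeniusSq S + ((n : ℝ) - 1)⁻¹ * (S.trace ^ 2 + frobeniusSq S))
        + 2 * w * (1 - w) * ∑ a, ∑ b, S a b * S' a b
        + (1 - w) ^ 2 * (frobeniusSq S' + ((m : ℝ) - 1)⁻¹ * (S'.trace ^ 2 + frobeniusSq S')) := by
  have key := fun a b : Fin p => integral_mix_mul (gaussianSample n μ S) (gaussianSample m μ' S') w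
    (1 - w) (integrable_sampleCov μ a b) (integrable_sampleCov μ a b) (integrable_sampleCov μ' a b)
    (integrable_sampleCov μ' a b) (integrable_sampleCov_mul μ a b a b)
    (integrable_sampleCov_mul μ' a b a b)
  simp_rw [frobeniusSq, mixCov_apply, sq (_ + _)]
  refine ⟨integrable_finsetSum _ fun a _ => integrable_finsetSum _ fun b _ => (key a b).1, ?_⟩
  rw [integral_finsetSum _ fun a _ => integrable_finsetSum _ fun b _ => (key a b).1]
  simp_rw [integral_finsetSum Finset.univ fun b _ => (key _ b).1, fun a b => (key a b).2,
    integral_sampleCov μ hS hn, integral_sampleCov μ' hS' hm, integral_sampleCov_mul μ hS hn,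
    integral_sampleCov_mul μ' hS' hm]
  -- The patterns split only the outer three terms, leaving the Isserlis summands intact for
  -- `sum_isserlis_frobenius`.
  simp only [Finset.sum_add_distrib (f := fun b => _ + _),
    Finset.sum_add_distrib (f := fun b => w ^ 2 * _), ← Finset.mul_sum,
    sum_isserlis_frobenius hS, sum_isserlis_frobenius hS']
  simp only [frobeniusSq, ← two_mul, ← Finset.mul_sum]
  ring

theorem integral_trace_sq_mixCov (hS : S.PosSemidef) (hS' : S'.PosSemidef) (hn : 2 ≤ n)
    (hm : 2 ≤ m) :
    Integrable (fun u => (mixCov w u).trace ^ 2)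
      ((gaussianSample n μ S).prod (gaussianSample m μ' S')) ∧
    ∫ u, (mixCov w u).trace ^ 2 ∂(gaussianSample n μ S).prod (gaussianSample m μ' S') =
      w ^ 2 * (S.trace ^ 2 + 2 * ((n : ℝ) - 1)⁻¹ * frobeniusSq S)
        + 2 * w * (1 - w) * (S.trace * S'.trace)
        + (1 - w) ^ 2 * (S'.trace ^ 2 + 2 * ((m : ℝ) - 1)⁻¹ * frobeniusSq S') := by
  have I : ∀ {N : ℕ} (ξ : EuclideanSpace ℝ (Fin p)) (T : Matrix (Fin p) (Fin p) ℝ),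
      Integrable (fun z => (sampleCov z).trace) (gaussianSample N ξ T) := fun ξ T =>
    integrable_finsetSum _ fun a _ => integrable_sampleCov ξ a a
  have E : ∀ {N : ℕ} (ξ : EuclideanSpace ℝ (Fin p)) {T : Matrix (Fin p) (Fin p) ℝ},
      T.PosSemidef → 2 ≤ N → ∫ z, (sampleCov z).trace ∂gaussianSample N ξ T = T.trace := by
    intro N ξ T hT hN
    simp only [Matrix.trace, Matrix.diag]
    rw [integral_finsetSum _ fun a _ => integrable_sampleCov ξ a a]
    simp_rw [integral_sampleCov ξ hT hN]
  have hA := integral_trace_sq_sampleCov μ hS hn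
  have hB := integral_trace_sq_sampleCov μ' hS' hm
  simp_rw [sq (Matrix.trace (sampleCov _))] at hA hB
  have key := integral_mix_mul (gaussianSample n μ S) (gaussianSample m μ' S') w
    (1 - w) (I μ S) (I μ S) (I μ' S') (I μ' S') hA.1 hB.1
  have e : (fun u : (Fin n → EuclideanSpace ℝ (Fin p)) × (Fin m → EuclideanSpace ℝ (Fin p)) =>
      (mixCov w u).trace ^ 2) = fun u =>
        (w * (sampleCov u.1).trace + (1 - w) * (sampleCov u.2).trace) *
        (w * (sampleCov u.1).trace + (1 - w) * (sampleCov u.2).trace) := by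
    funext u
    simp [mixCov, sq]
  rw [e]
  refine ⟨key.1, ?_⟩
  rw [key.2, hA.2, hB.2, E μ hS hn, E μ' hS' hm]
  ring

end Step

/-! ### Positivity and measurability of the covariance estimators -/

section Matrices

variable {p n m : ℕ}

theorem frobeniusSq_nonneg (A : Matrix (Fin p) (Fin p) ℝ) : 0 ≤ frobeniusSq A :=
  Finset.sum_nonneg fun _ _ => Finset.sum_nonneg fun _ _ => sq_nonneg _

theorem sq_apply_le_frobeniusSq (A : Matrix (Fin p) (Fin p) ℝ) (a b : Fin p) :
    A a b ^ 2 ≤ frobeniusSq A :=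
  (Finset.single_le_sum (f := fun b => A a b ^ 2) (fun _ _ => sq_nonneg _) (Finset.mem_univ b)).trans
    (Finset.single_le_sum (f := fun a => ∑ b, A a b ^ 2)
      (fun _ _ => Finset.sum_nonneg fun _ _ => sq_nonneg _) (Finset.mem_univ a))

/-- Supplies the dominating function needed for the signed entries in
`integral_eq_integral_condLaw`. -/
theorem abs_apply_le_one_add_frobeniusSq (A : Matrix (Fin p) (Fin p) ℝ) (a b : Fin p) :
    |A a b| ≤ 1 + frobeniusSq A := by
  have h := sq_apply_le_frobeniusSq A a b
  rw [abs_le]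
  constructor <;> nlinarith [sq_nonneg (A a b - 1), sq_nonneg (A a b + 1)]

theorem frobeniusSq_pos {A : Matrix (Fin p) (Fin p) ℝ} (hA : A ≠ 0) : 0 < frobeniusSq A := by
  obtain ⟨a, b, hab⟩ : ∃ a b, A a b ≠ 0 := by
    by_contra! h
    exact hA (Matrix.ext h)
  exact (by positivity : 0 < A a b ^ 2).trans_le (sq_apply_le_frobeniusSq A a b)

theorem posSemidef_sampleCov {N : ℕ} (hN : 2 ≤ N) (z : Fin N → EuclideanSpace ℝ (Fin p)) :
    (sampleCov z).PosSemidef := by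
  have : (2 : ℝ) ≤ N := by exact_mod_cast hN
  refine Matrix.PosSemidef.smul (Matrix.posSemidef_sum _ fun i _ => ?_)
    (inv_nonneg.2 (by linarith))
  simpa using Matrix.posSemidef_vecMulVec_self_star (z i - sampleMean z).ofLp

theorem measurable_frobeniusSq_mixCov (w : ℝ) :
    Measurable (fun u => frobeniusSq (mixCov (p := p) (n := n) (m := m) w u)) :=
  Finset.measurable_sum _ fun a _ => Finset.measurable_sum _ fun b _ =>
    (measurable_mixCov_apply w a b).pow_const 2

theorem measurable_trace_mixCov (w : ℝ) :
    Measurable (fun u => (mixCov (p := p) (n := n) (m := m) w u).trace) :=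
  Finset.measurable_sum _ fun a _ => measurable_mixCov_apply w a a

/-- Holds for every `ω`, so that the Gaussian moment formulas apply to each fitted model. -/
theorem posSemidef_covEst {Ω : Type*} {w : ℝ} (hn : 2 ≤ n) (hm : 2 ≤ m) (hw0 : 0 ≤ w) (hw1 : w ≤ 1)
    (x : ℕ → Fin n → Ω → EuclideanSpace ℝ (Fin p)) (y : ℕ → Fin m → Ω → EuclideanSpace ℝ (Fin p))
    (t : ℕ) (ω : Ω) : (covEst w x y t ω).PosSemidef := by
  cases t with
  | zero => exact posSemidef_sampleCov hn _
  | succ t =>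
    exact ((posSemidef_sampleCov hn _).smul hw0).add
      ((posSemidef_sampleCov hm _).smul (by linarith : (0 : ℝ) ≤ 1 - w))

end Matrices

/-! ### Recursions for the moments of the estimators -/

section Scheme

variable {Ω : Type*} [mΩ : MeasurableSpace Ω] {P : Measure Ω} {p n m : ℕ}
  {w : ℝ} {μ : EuclideanSpace ℝ (Fin p)} {S : Matrix (Fin p) (Fin p) ℝ}
  {x : ℕ → Fin n → Ω → EuclideanSpace ℝ (Fin p)} {y : ℕ → Fin m → Ω → EuclideanSpace ℝ (Fin p)}

theorem IsScheme.history_le (hxy : IsScheme P w μ S x y) (t : ℕ) : history x y t ≤ mΩ :=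
  sup_le
    (iSup_le fun s => iSup_le fun _ => iSup_le fun i => (hxy.measurable_real s i).comap_le)
    (iSup_le fun s => iSup_le fun _ => iSup_le fun i => (hxy.measurable_synthetic s i).comap_le)

theorem IsScheme.measurable_data (hxy : IsScheme P w μ S x y) (t : ℕ) :
    Measurable (fun ω => ((fun i => x (t + 1) i ω), (fun i => y t i ω))) :=
  (measurable_pi_lambda _ fun i => hxy.measurable_real (t + 1) i).prodMk
    (measurable_pi_lambda _ fun i => hxy.measurable_synthetic t i)

theorem IsScheme.integral_init (hxy : IsScheme P w μ S x y)
    {f : (Fin n → EuclideanSpace ℝ (Fin p)) → ℝ} (hf : Integrable f (gaussianSample n μ S)) :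
    Integrable (fun ω => f (fun i => x 0 i ω)) P ∧
      ∫ ω, f (fun i => x 0 i ω) ∂P = ∫ z, f z ∂gaussianSample n μ S := by
  have hm : Measurable (fun ω i => x 0 i ω) := measurable_pi_lambda _ fun i => hxy.measurable_real 0 i
  rw [← hxy.law_init] at hf ⊢
  exact ⟨hf.comp_measurable hm, (integral_map hm.aemeasurable hf.aestronglyMeasurable).symm⟩

/-- The matrix `C` has square-integrable entries, with mean `S`. -/
structure HasMeanSq (P : Measure Ω) (S : Matrix (Fin p) (Fin p) ℝ)
    (C : Ω → Matrix (Fin p) (Fin p) ℝ) : Prop where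
  integrable_apply : ∀ a b, Integrable (fun ω => C ω a b) P
  integral_apply : ∀ a b, ∫ ω, C ω a b ∂P = S a b
  integrable_frobeniusSq : Integrable (fun ω => frobeniusSq (C ω)) P
  integrable_trace_sq : Integrable (fun ω => (C ω).trace ^ 2) P

theorem HasMeanSq.integral_trace {C : Ω → Matrix (Fin p) (Fin p) ℝ} (hC : HasMeanSq P S C) :
    Integrable (fun ω => (C ω).trace) P ∧ ∫ ω, (C ω).trace ∂P = S.trace := by
  simp only [Matrix.trace, Matrix.diag]
  refine ⟨integrable_finsetSum _ fun a _ => hC.integrable_apply a a, ?_⟩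
  rw [integral_finsetSum _ fun a _ => hC.integrable_apply a a]
  simp_rw [hC.integral_apply]

theorem HasMeanSq.integral_inner {C : Ω → Matrix (Fin p) (Fin p) ℝ} (hC : HasMeanSq P S C) :
    Integrable (fun ω => ∑ a, ∑ b, S a b * C ω a b) P ∧
      ∫ ω, ∑ a, ∑ b, S a b * C ω a b ∂P = frobeniusSq S := by
  have I := fun a b => (hC.integrable_apply a b).const_mul (S a b)
  refine ⟨integrable_finsetSum _ fun a _ => integrable_finsetSum _ fun b _ => I a b, ?_⟩
  rw [integral_finsetSum _ fun a _ => integrable_finsetSum _ fun b _ => I a b]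
  simp_rw [integral_finsetSum Finset.univ fun b _ => I _ b, integral_const_mul, hC.integral_apply,
    frobeniusSq, sq]

theorem IsScheme.hasMeanSq_zero (hxy : IsScheme P w μ S x y) (hS : S.PosSemidef) (hn : 2 ≤ n) :
    HasMeanSq P S (covEst w x y 0) where
  integrable_apply a b := (hxy.integral_init (integrable_sampleCov μ a b)).1
  integral_apply a b :=
    (hxy.integral_init (integrable_sampleCov μ a b)).2.trans (integral_sampleCov μ hS hn a b)
  integrable_frobeniusSq := (hxy.integral_init (integral_frobeniusSq_sampleCov μ hS hn).1).1
  integrable_trace_sq := (hxy.integral_init (integral_trace_sq_sampleCov μ hS hn).1).1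

variable [IsProbabilityMeasure P]

theorem integral_affine {f g h : Ω → ℝ} (c α β γ : ℝ) (hf : Integrable f P) (hg : Integrable g P)
    (hh : Integrable h P) :
    Integrable (fun ω => c + α * f ω + β * g ω + γ * h ω) P ∧
      ∫ ω, (c + α * f ω + β * g ω + γ * h ω) ∂P =
        c + α * ∫ ω, f ω ∂P + β * ∫ ω, g ω ∂P + γ * ∫ ω, h ω ∂P := by
  have i1 : Integrable (fun ω => c + α * f ω) P := (integrable_const c).add (hf.const_mul α)
  have i2 : Integrable (fun ω => c + α * f ω + β * g ω) P := i1.add (hg.const_mul β)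
  refine ⟨i2.add (hh.const_mul γ), ?_⟩
  rw [integral_add i2 (hh.const_mul γ), integral_add i1 (hg.const_mul β),
    integral_add (integrable_const c) (hf.const_mul α), integral_const_mul, integral_const_mul,
    integral_const_mul]
  simp

/-- Bias-variance identity: as `C` has mean `S`, the cross term integrates to `-2‖S‖²`. -/
theorem HasMeanSq.integral_frobeniusSq_sub {C : Ω → Matrix (Fin p) (Fin p) ℝ}
    (hC : HasMeanSq P S C) :
    Integrable (fun ω => frobeniusSq (C ω - S)) P ∧
      ∫ ω, frobeniusSq (C ω - S) ∂P = ∫ ω, frobeniusSq (C ω) ∂P - frobeniusSq S := by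
  have e : (fun ω => frobeniusSq (C ω - S)) = fun ω =>
      (frobeniusSq (C ω) - 2 * ∑ a, ∑ b, S a b * C ω a b) + frobeniusSq S := by
    funext ω
    simp only [frobeniusSq, Finset.mul_sum, ← Finset.sum_sub_distrib, ← Finset.sum_add_distrib]
    refine Finset.sum_congr rfl fun a _ => Finset.sum_congr rfl fun b _ => ?_
    rw [Matrix.sub_apply]
    ring
  have i1 := hC.integral_inner.1.const_mul 2
  have i2 : Integrable (fun ω => frobeniusSq (C ω) - 2 * ∑ a, ∑ b, S a b * C ω a b) P :=
    hC.integrable_frobeniusSq.sub i1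
  rw [e]
  refine ⟨i2.add (integrable_const _), ?_⟩
  rw [integral_add i2 (integrable_const _), integral_sub hC.integrable_frobeniusSq i1,
    integral_const_mul, hC.integral_inner.2]
  simp
  ring

variable (hxy : IsScheme P w μ S x y) (hS : S.PosSemidef) (hn : 2 ≤ n) (hm : 2 ≤ m)
  (hw0 : 0 ≤ w) (hw1 : w ≤ 1)

include hxy hS hn hm hw0 hw1

/-- The conditional moment is affine in `⟨S, Σ_t⟩`, `‖Σ_t‖²` and `(tr Σ_t)²`; unbiasedness evaluates
the first. -/
theorem IsScheme.integral_frobeniusSq_succ {t : ℕ} (hC : HasMeanSq P S (covEst w x y t)) :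
    Integrable (fun ω => frobeniusSq (covEst w x y (t + 1) ω)) P ∧
    ∫ ω, frobeniusSq (covEst w x y (t + 1) ω) ∂P =
      w ^ 2 * (frobeniusSq S + ((n : ℝ) - 1)⁻¹ * (S.trace ^ 2 + frobeniusSq S))
        + 2 * w * (1 - w) * frobeniusSq S
        + (1 - w) ^ 2 * (∫ ω, frobeniusSq (covEst w x y t ω) ∂P + ((m : ℝ) - 1)⁻¹ *
          (∫ ω, (covEst w x y t ω).trace ^ 2 ∂P + ∫ ω, frobeniusSq (covEst w x y t ω) ∂P)) := by
  have key := fun ω => integral_frobeniusSq_mixCov w μ (meanEst w x y t ω) hS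
    (posSemidef_covEst hn hm hw0 hw1 x y t ω) hn hm
  have aff := integral_affine (w ^ 2 * (frobeniusSq S +
      ((n : ℝ) - 1)⁻¹ * (S.trace ^ 2 + frobeniusSq S))) (2 * w * (1 - w))
    ((1 - w) ^ 2 * (1 + ((m : ℝ) - 1)⁻¹)) ((1 - w) ^ 2 * ((m : ℝ) - 1)⁻¹)
    hC.integral_inner.1 hC.integrable_frobeniusSq hC.integrable_trace_sq
  have h := integral_eq_integral_condLaw_of_nonneg (hxy.history_le t) (hxy.measurable_data t)
    (hxy.cond_law t) (measurable_frobeniusSq_mixCov w) (fun u => frobeniusSq_nonneg _)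
    (fun ω => (key ω).1) (fun ω => (key ω).2.trans (by ring)) aff.1
  refine ⟨h.1, h.2.trans ?_⟩
  rw [aff.2, hC.integral_inner.2]
  ring

theorem IsScheme.integral_trace_sq_succ {t : ℕ} (hC : HasMeanSq P S (covEst w x y t)) :
    Integrable (fun ω => (covEst w x y (t + 1) ω).trace ^ 2) P ∧
    ∫ ω, (covEst w x y (t + 1) ω).trace ^ 2 ∂P =
      w ^ 2 * (S.trace ^ 2 + 2 * ((n : ℝ) - 1)⁻¹ * frobeniusSq S)
        + 2 * w * (1 - w) * (S.trace * S.trace)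
        + (1 - w) ^ 2 * (∫ ω, (covEst w x y t ω).trace ^ 2 ∂P + 2 * ((m : ℝ) - 1)⁻¹ *
          ∫ ω, frobeniusSq (covEst w x y t ω) ∂P) := by
  have key := fun ω => integral_trace_sq_mixCov w μ (meanEst w x y t ω) hS
    (posSemidef_covEst hn hm hw0 hw1 x y t ω) hn hm
  have aff := integral_affine (w ^ 2 * (S.trace ^ 2 + 2 * ((n : ℝ) - 1)⁻¹ * frobeniusSq S))
    (2 * w * (1 - w) * S.trace) ((1 - w) ^ 2) ((1 - w) ^ 2 * (2 * ((m : ℝ) - 1)⁻¹))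
    hC.integral_trace.1 hC.integrable_trace_sq hC.integrable_frobeniusSq
  have h := integral_eq_integral_condLaw_of_nonneg (hxy.history_le t) (hxy.measurable_data t)
    (hxy.cond_law t) ((measurable_trace_mixCov w).pow_const 2) (fun u => sq_nonneg _)
    (fun ω => (key ω).1) (fun ω => (key ω).2.trans (by ring)) aff.1
  refine ⟨h.1, h.2.trans ?_⟩
  rw [aff.2, hC.integral_trace.2]
  ring

theorem IsScheme.integral_apply_succ {t : ℕ} (hC : HasMeanSq P S (covEst w x y t)) (a b : Fin p) :
    Integrable (fun ω => covEst w x y (t + 1) ω a b) P ∧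
      ∫ ω, covEst w x y (t + 1) ω a b ∂P = S a b := by
  have hpsd := posSemidef_covEst hn hm hw0 hw1 x y t
  have key := fun ω => integral_mixCov w μ (meanEst w x y t ω) hS (hpsd ω) hn hm a b
  have keyF := fun ω => integral_frobeniusSq_mixCov w μ (meanEst w x y t ω) hS (hpsd ω) hn hm
  have affF := integral_affine (1 + w ^ 2 * (frobeniusSq S +
      ((n : ℝ) - 1)⁻¹ * (S.trace ^ 2 + frobeniusSq S))) (2 * w * (1 - w))
    ((1 - w) ^ 2 * (1 + ((m : ℝ) - 1)⁻¹)) ((1 - w) ^ 2 * ((m : ℝ) - 1)⁻¹)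
    hC.integral_inner.1 hC.integrable_frobeniusSq hC.integrable_trace_sq
  have i1 := (hC.integrable_apply a b).const_mul (1 - w)
  have i2 : Integrable (fun ω => w * S a b + (1 - w) * covEst w x y t ω a b) P :=
    (integrable_const _).add i1
  have h := integral_eq_integral_condLaw (hxy.history_le t) (hxy.measurable_data t)
    (hxy.cond_law t) (h := fun u => 1 + frobeniusSq (mixCov w u)) (measurable_mixCov_apply w a b)
    (measurable_const.add (measurable_frobeniusSq_mixCov w))
    (fun u => abs_apply_le_one_add_frobeniusSq _ a b)
    (fun ω => (key ω).1) (fun ω => (key ω).2) i2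
    (fun ω => (integrable_const _).add (keyF ω).1)
    (fun ω => by
      rw [integral_add (integrable_const (1 : ℝ)) (keyF ω).1, (keyF ω).2, integral_const,
        probReal_univ, one_smul]
      ring) affF.1
  refine ⟨h.1, h.2.trans ?_⟩
  rw [integral_add (integrable_const _) i1, integral_const, integral_const_mul, hC.integral_apply,
    probReal_univ, one_smul]
  ring

theorem IsScheme.hasMeanSq (t : ℕ) : HasMeanSq P S (covEst w x y t) := by
  induction t with
  | zero => exact hxy.hasMeanSq_zero hS hn
  | succ t ih => exact
    { integrable_apply := fun a b => (hxy.integral_apply_succ hS hn hm hw0 hw1 ih a b).1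
      integral_apply := fun a b => (hxy.integral_apply_succ hS hn hm hw0 hw1 ih a b).2
      integrable_frobeniusSq := (hxy.integral_frobeniusSq_succ hS hn hm hw0 hw1 ih).1
      integrable_trace_sq := (hxy.integral_trace_sq_succ hS hn hm hw0 hw1 ih).1 }

theorem IsScheme.integral_norm_meanEst_succ {t : ℕ}
    (hM : Integrable (fun ω => ‖meanEst w x y t ω - μ‖ ^ 2) P) :
    Integrable (fun ω => ‖meanEst w x y (t + 1) ω - μ‖ ^ 2) P ∧
    ∫ ω, ‖meanEst w x y (t + 1) ω - μ‖ ^ 2 ∂P =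
      w ^ 2 * (S.trace / n) + (1 - w) ^ 2 * (S.trace / m + ∫ ω, ‖meanEst w x y t ω - μ‖ ^ 2 ∂P) := by
  have hC := hxy.hasMeanSq hS hn hm hw0 hw1 t
  have key := fun ω => integral_norm_mixMean_sub_sq w μ (meanEst w x y t ω) hS
    (posSemidef_covEst hn hm hw0 hw1 x y t ω) (by omega : n ≠ 0) (by omega : m ≠ 0)
  -- Only two statistics occur, so the third slot is filled with coefficient 0.
  have aff := integral_affine (w ^ 2 * (S.trace / n)) ((1 - w) ^ 2 / m) ((1 - w) ^ 2) 0
    hC.integral_trace.1 hM hM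
  have h := integral_eq_integral_condLaw_of_nonneg (hxy.history_le t) (hxy.measurable_data t)
    (hxy.cond_law t) (((measurable_mixMean w).sub_const μ).norm.pow_const 2) (fun u => sq_nonneg _)
    (fun ω => (key ω).1) (fun ω => (key ω).2.trans (by ring)) aff.1
  refine ⟨h.1, h.2.trans ?_⟩
  rw [aff.2, hC.integral_trace.2]
  ring

theorem IsScheme.integrable_norm_meanEst (t : ℕ) :
    Integrable (fun ω => ‖meanEst w x y t ω - μ‖ ^ 2) P := by
  induction t with
  | zero =>
    exact (hxy.integral_init (integral_norm_sampleMean_sub_sq μ hS (by omega : n ≠ 0)).1).1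
  | succ t ih => exact (hxy.integral_norm_meanEst_succ hS hn hm hw0 hw1 ih).1

end Scheme

/-! ### Affine recursions and the limiting values -/

theorem tendsto_affine_recursion {u : ℕ → ℝ} {c r : ℝ} (hr0 : 0 ≤ r) (hr1 : r < 1)
    (hu : ∀ t, u (t + 1) = c + r * u t) : Tendsto u atTop (𝓝 (c / (1 - r))) := by
  have h1 : 1 - r ≠ 0 := by linarith
  have e : ∀ t, u t = c / (1 - r) + r ^ t * (u 0 - c / (1 - r)) := by
    intro t
    induction t with
    | zero => simp
    | succ t ih =>
      rw [hu, ih, pow_succ]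
      field_simp
      ring
  have h := ((tendsto_pow_atTop_nhds_zero_of_lt_one hr0 hr1).mul_const
    (u 0 - c / (1 - r))).const_add (c / (1 - r))
  simp only [zero_mul, add_zero] at h
  exact h.congr fun t => (e t).symm

/-- A nonnegative sequence gains at least `c` per step; this includes the critical case `r = 1`. -/
theorem tendsto_affine_recursion_atTop {u : ℕ → ℝ} {c r : ℝ} (hc : 0 < c) (hr : 1 ≤ r)
    (hu0 : 0 ≤ u 0) (hu : ∀ t, u (t + 1) = c + r * u t) : Tendsto u atTop atTop := by
  have h : ∀ t : ℕ, t * c ≤ u t := by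
    intro t
    induction t with
    | zero => simpa using hu0
    | succ t ih =>
      have : 0 ≤ u t := le_trans (by positivity) ih
      rw [hu]
      push_cast
      nlinarith
  exact tendsto_atTop_mono h (tendsto_natCast_atTop_atTop.atTop_mul_const hc)

/-- The coupled recursion of the second moments `A` and `B` diverges exactly when
`a * (1 + 2 * c) ≥ 1`: the left eigenvectors `2A + B` and `A - B` decouple it. -/
theorem tendsto_coupled_recursion {A B : ℕ → ℝ} {a c α β : ℝ} (ha0 : 0 ≤ a) (ha1 : a < 1)
    (hc0 : 0 < c) (hc1 : c ≤ 1) (hα : 0 < α) (hβ : 0 ≤ β) (hA0 : 0 ≤ A 0) (hB0 : 0 ≤ B 0)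
    (hA : ∀ t, A (t + 1) = α + a * (A t + c * (B t + A t)))
    (hB : ∀ t, B (t + 1) = β + a * (B t + 2 * c * A t)) :
    (1 ≤ a * (1 + 2 * c) → Tendsto A atTop atTop) ∧
    (a * (1 + 2 * c) < 1 → Tendsto A atTop
      (𝓝 (((2 * α + β) / (1 - a * (1 + 2 * c)) + (α - β) / (1 - a * (1 - c))) / 3))) := by
  -- This mode converges in both regimes because `0 ≤ 1 - c < 1`. Divergence is thus decided by `2A
  -- + B`, and `A` is recovered as a third of the sum of the two modes.
  have hR := tendsto_affine_recursion (u := fun t => A t - B t) (c := α - β) (r := a * (1 - c))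
    (mul_nonneg ha0 (by linarith)) (by nlinarith) (fun t => by simp only [hA, hB]; ring)
  have hQ : ∀ t, 2 * A (t + 1) + B (t + 1) = (2 * α + β) + a * (1 + 2 * c) * (2 * A t + B t) :=
    fun t => by rw [hA, hB]; ring
  refine ⟨fun h => ?_, fun h => ?_⟩
  · have hQ' := tendsto_affine_recursion_atTop (u := fun t => 2 * A t + B t) (by linarith) h
      (by linarith) hQ
    refine ((hQ'.atTop_add hR).atTop_div_const (by norm_num : (0 : ℝ) < 3)).congr fun t => ?_
    ring
  · have hQ' := tendsto_affine_recursion (u := fun t => 2 * A t + B t) (by positivity) h hQ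
    refine ((hQ'.add hR).div_const 3).congr fun t => ?_
    ring

/-- Squaring is reversible since `1 - w ≥ 0`, and `1 + 2/(m-1) = (m+1)/(m-1)`. -/
theorem le_one_sub_sqrt_iff {m : ℕ} (hm : 2 ≤ m) {w : ℝ} (hw1 : w ≤ 1) :
    w ≤ 1 - √(((m : ℝ) - 1) / ((m : ℝ) + 1)) ↔ 1 ≤ (1 - w) ^ 2 * (1 + 2 * ((m : ℝ) - 1)⁻¹) := by
  have hm' : (2 : ℝ) ≤ m := by exact_mod_cast hm
  have h1 : (0 : ℝ) < m - 1 := by linarith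
  have h2 : (0 : ℝ) < m + 1 := by linarith
  rw [le_sub_comm, Real.sqrt_le_left (by linarith), div_le_iff₀ h2]
  have e : (1 - w) ^ 2 * (1 + 2 * ((m : ℝ) - 1)⁻¹) = (1 - w) ^ 2 * (m + 1) / (m - 1) := by
    field_simp
    ring
  rw [e, le_div_iff₀ h1, one_mul]

/-- The key factorization is `D (1 - a) = (1 - a(1+2c)) (1 - a(1-c))`. In use `k = w²/(n-1)` and `e
= w² + 2w(1-w) = 2w - w²`. -/
theorem limit_second_moment_eq {a c d q r e D : ℝ} (hd : d = 1 - a) (hd0 : d ≠ 0)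
    (hD : D = d - 2 * a ^ 2 * c ^ 2 / d - a * c) (h1 : 1 - a * (1 + 2 * c) ≠ 0)
    (h2 : 1 - a * (1 - c) ≠ 0) (k : ℝ) :
    ((2 * (e * q + k * (r + q)) + (e * r + 2 * k * q)) / (1 - a * (1 + 2 * c)) +
      ((e * q + k * (r + q)) - (e * r + 2 * k * q)) / (1 - a * (1 - c))) / 3 =
      (e * q + a * c * (r * e + 2 * k * q) / d + k * (r + q)) / D := by
  subst hd
  have hD' : D = (1 - a * (1 + 2 * c)) * (1 - a * (1 - c)) / (1 - a) := by
    rw [hD]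
    field_simp
    ring
  rw [hD']
  field_simp
  ring

theorem numN_div_denD_eq {p n m : ℕ} {S : Matrix (Fin p) (Fin p) ℝ} (hS : S.PosSemidef) {w : ℝ}
    (hm : 2 ≤ m) (hw0 : 0 < w) (hw1 : w ≤ 1)
    (h : (1 - w) ^ 2 * (1 + 2 * ((m : ℝ) - 1)⁻¹) < 1) :
    ((2 * (w ^ 2 * (frobeniusSq S + ((n : ℝ) - 1)⁻¹ * (S.trace ^ 2 + frobeniusSq S))
        + 2 * w * (1 - w) * frobeniusSq S) +
        (w ^ 2 * (S.trace ^ 2 + 2 * ((n : ℝ) - 1)⁻¹ * frobeniusSq S)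
        + 2 * w * (1 - w) * (S.trace * S.trace))) / (1 - (1 - w) ^ 2 * (1 + 2 * ((m : ℝ) - 1)⁻¹)) +
      ((w ^ 2 * (frobeniusSq S + ((n : ℝ) - 1)⁻¹ * (S.trace ^ 2 + frobeniusSq S))
        + 2 * w * (1 - w) * frobeniusSq S) -
        (w ^ 2 * (S.trace ^ 2 + 2 * ((n : ℝ) - 1)⁻¹ * frobeniusSq S)
        + 2 * w * (1 - w) * (S.trace * S.trace))) / (1 - (1 - w) ^ 2 * (1 - ((m : ℝ) - 1)⁻¹))) / 3
      = numN n m w S / denD m w := by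
  have hm' : (2 : ℝ) ≤ m := by exact_mod_cast hm
  have hc : 0 < ((m : ℝ) - 1)⁻¹ := inv_pos.2 (by linarith)
  have hd0 : 2 * w - w ^ 2 ≠ 0 := by nlinarith
  have key := limit_second_moment_eq (a := (1 - w) ^ 2) (c := ((m : ℝ) - 1)⁻¹) (d := 2 * w - w ^ 2)
    (q := frobeniusSq S) (r := S.trace ^ 2) (e := 2 * w - w ^ 2) (D := denD m w) (by ring) hd0
    (by
      rw [denD]
      have h1 : (m : ℝ) - 1 ≠ 0 := by linarith
      field_simp
      ring) (by linarith) (by nlinarith [sq_nonneg (1 - w)]) (w ^ 2 * ((n : ℝ) - 1)⁻¹)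
  rw [numN, ← frobeniusSq_eq_trace hS]
  convert key using 2
  · ring
  · have h1 : (m : ℝ) - 1 ≠ 0 := by linarith
    generalize (2 * w - w ^ 2) = d at *
    simp only [div_eq_mul_inv, mul_inv]
    ring

theorem toEReal_lintegral_ofReal {Ω : Type*} [MeasurableSpace Ω] {P : Measure Ω} {f : Ω → ℝ}
    (hf : Integrable f P) (hf0 : ∀ ω, 0 ≤ f ω) :
    ((∫⁻ ω, ENNReal.ofReal (f ω) ∂P : ENNReal) : EReal) = ((∫ ω, f ω ∂P : ℝ) : EReal) := by
  rw [← ofReal_integral_eq_lintegral_ofReal hf (ae_of_all _ hf0), EReal.coe_ennreal_ofReal,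
    max_eq_left (integral_nonneg hf0)]

end FreshAugmentation

theorem theorem1 {Ω : Type*} [MeasurableSpace Ω] (P : Measure Ω) [IsProbabilityMeasure P]
    (p n m : ℕ) (hn : 2 ≤ n) (hm : 2 ≤ m) (w : ℝ) (hw0 : 0 < w) (hw1 : w ≤ 1)
    (μ : EuclideanSpace ℝ (Fin p)) (S : Matrix (Fin p) (Fin p) ℝ)
    (hS : S.PosSemidef) (hS0 : S ≠ 0)
    (x : ℕ → Fin n → Ω → EuclideanSpace ℝ (Fin p))
    (y : ℕ → Fin m → Ω → EuclideanSpace ℝ (Fin p))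
    (hxy : FreshAugmentation.IsScheme P w μ S x y) :
    Tendsto (FreshAugmentation.errMean P w μ x y) atTop
      (𝓝 ((FreshAugmentation.constC w ((n : ℝ) / (m : ℝ)) * S.trace / (n : ℝ) : ℝ) : EReal)) ∧
    Tendsto (FreshAugmentation.errCov P w S x y) atTop
      (𝓝 (if w ≤ 1 - √(((m : ℝ) - 1) / ((m : ℝ) + 1)) then (⊤ : EReal)
        else ((FreshAugmentation.numN n m w S / FreshAugmentation.denD m w - (S ^ 2).trace : ℝ) :
          EReal))) := by
  open FreshAugmentation in
  have hn' : (2 : ℝ) ≤ n := by exact_mod_cast hn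
  have hm' : (2 : ℝ) ≤ m := by exact_mod_cast hm
  have ha1 : (1 - w) ^ 2 < 1 := by nlinarith
  constructor
  · have hI := hxy.integrable_norm_meanEst hS hn hm hw0.le hw1
    have e : errMean P w μ x y = fun t => ((∫ ω, ‖meanEst w x y t ω - μ‖ ^ 2 ∂P : ℝ) : EReal) :=
      funext fun t => toEReal_lintegral_ofReal (hI t) fun ω => sq_nonneg _
    have hlim := tendsto_affine_recursion (u := fun t => ∫ ω, ‖meanEst w x y t ω - μ‖ ^ 2 ∂P)
      (c := w ^ 2 * (S.trace / n) + (1 - w) ^ 2 * (S.trace / m)) (sq_nonneg (1 - w)) ha1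
      (fun t => by
        simp only [(hxy.integral_norm_meanEst_succ hS hn hm hw0.le hw1 (hI t)).2]
        ring)
    have hval : (w ^ 2 * (S.trace / n) + (1 - w) ^ 2 * (S.trace / m)) / (1 - (1 - w) ^ 2) =
        constC w ((n : ℝ) / (m : ℝ)) * S.trace / (n : ℝ) := by
      have hd : 1 - (1 - w) ^ 2 = 2 * w - w ^ 2 := by ring
      have hd0 : 2 * w - w ^ 2 ≠ 0 := by nlinarith
      rw [constC, hd]
      field_simp
    rw [e, ← hval]
    exact (continuous_coe_real_ereal.tendsto _).comp hlim
  · have hC := hxy.hasMeanSq hS hn hm hw0.le hw1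
    have e : errCov P w S x y = fun t =>
        ((∫ ω, frobeniusSq (covEst w x y t ω) ∂P - frobeniusSq S : ℝ) : EReal) :=
      funext fun t => (toEReal_lintegral_ofReal (hC t).integral_frobeniusSq_sub.1
        fun ω => frobeniusSq_nonneg _).trans (by rw [(hC t).integral_frobeniusSq_sub.2])
    -- `S ≠ 0` makes the forcing term `α` positive, which drives the divergence.
    have hq := frobeniusSq_pos hS0
    have hcn : 0 < ((n : ℝ) - 1)⁻¹ := inv_pos.2 (by linarith)
    have hw1' : 0 ≤ 1 - w := by linarith
    have hlim := tendsto_coupled_recursion (A := fun t => ∫ ω, frobeniusSq (covEst w x y t ω) ∂P)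
      (B := fun t => ∫ ω, (covEst w x y t ω).trace ^ 2 ∂P) (a := (1 - w) ^ 2)
      (c := ((m : ℝ) - 1)⁻¹)
      (α := w ^ 2 * (frobeniusSq S + ((n : ℝ) - 1)⁻¹ * (S.trace ^ 2 + frobeniusSq S))
        + 2 * w * (1 - w) * frobeniusSq S)
      (β := w ^ 2 * (S.trace ^ 2 + 2 * ((n : ℝ) - 1)⁻¹ * frobeniusSq S)
        + 2 * w * (1 - w) * (S.trace * S.trace))
      (sq_nonneg _) ha1 (inv_pos.2 (by linarith)) (inv_le_one_of_one_le₀ (by linarith))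
      (by positivity) (add_nonneg (by positivity) (mul_nonneg (by positivity) (mul_self_nonneg _)))
      (integral_nonneg fun ω => frobeniusSq_nonneg _) (integral_nonneg fun ω => sq_nonneg _)
      (fun t => (hxy.integral_frobeniusSq_succ hS hn hm hw0.le hw1 (hC t)).2)
      (fun t => (hxy.integral_trace_sq_succ hS hn hm hw0.le hw1 (hC t)).2)
    rw [e]
    simp only [le_one_sub_sqrt_iff hm hw1]
    split_ifs with h
    · exact EReal.tendsto_coe_nhds_top_iff.2 (tendsto_atTop_add_const_right _ _ (hlim.1 h))
    · have h2 := hlim.2 (not_le.1 h)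
      rw [numN_div_denD_eq hS hm hw0 hw1 (not_le.1 h)] at h2
      rw [← frobeniusSq_eq_trace hS]
      exact (continuous_coe_real_ereal.tendsto _).comp (h2.sub_const _)
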